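/- \textbf{Setting.} Let $\mathcal A$ (actions) and $\mathcal E$ (percepts) be finite sets and $\Sigma=\mathcal A\sqcup\mathcal E$. A probabilistic Turing machine with oracle access (pTM) $T$ receives an input $x\in\Sigma^*$; it computes deterministically, may read fair random bits, and may put queries $(T',x',p)$ with index $\alpha$ to the oracle, where $T'$ is (the description of) a pTM, $x'\in\Sigma^*$, $p\in\mathbb Q\cap[0,1]$, $\alpha\in\mathcal A$. An oracle is a function $O$ with values $O_\alpha(T',x',p)\in[0,1]$; each such query is answered, independently, by $1$ with probability $O_\alpha(T',x',p)$ and by $0$ otherwise. Let $\lambda^O_T(\alpha\mid x)$ be the probability that $T$ with oracle $O$ halts on input $x$ with output the single symbol $\alpha$. The oracle $O$ is \emph{reflective} if for every pTM $T$ and $x\in\Sigma^*$ there are numbers $(q_\alpha)_{\alpha\in\mathcal A}$ with $\sum_\alpha q_\alpha=1$ such that for all $\alpha\in\mathcal A$ and $p\in\mathbb Q\cap[0,1]$ $$\lambda^O_T(\alpha\mid x)\le q_\alpha\le 1-\sum_{\beta\ne\alpha}\lambda^O_T(\beta\mid x),\qquad O_\alpha(T,x,p)=1\text{ if }p<q_\alpha,\qquad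 O_\alpha(T,x,p)=0\text{ if }p>q_\alpha .$$ These $q_\alpha$ are then unique; write $\bar\lambda^O_T(\alpha\mid x)=q_\alpha$. A strategy $\pi$ assigns to each history $h=a_1e_1\dots a_{t-1}e_{t-1}$ (with $a_i\in\mathcal A$, $e_i\in\mathcal E$) a probability distribution $\pi(\cdot\mid h)$ on $\mathcal A$; put $\pi(a_{\le t}\,\|\,e_{<t})=\prod_{s\le t}\pi(a_s\mid a_1e_1\dots a_{s-1}e_{s-1})$, and similarly $\pi(a_{<t}\,\|\,e_{<t})$. Let $\mathcal P^O_{\mathrm{refl}}$ be the set of strategies $\pi$ for which there is a pTM $T$ with $\pi(a\mid h)=\lambda_T^O(a\mid h)$ for all histories $h$ and all $a\in\mathcal A$. For a pTM $T$ and a reflective oracle $O$ let $\pi_T$ be the strategy $\pi_T(\cdot\mid h)=\bar\lambda^O_T(\cdot\mid h)$. \textbf{Theorem.} Let $O$ be a reflective oracle. There is $\zeta\in\mathcal P^O_{\mathrm{refl}}$ that multiplicatively dominates $\mathcal P^O_{\mathrm{refl}}$: for every $\pi\in\mathcal P^O_{\mathrm{refl}}$ there is $c>0$ such that $\zeta(a_{\le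 t}\,\|\,e_{<t})\ge c\,\pi(a_{\le t}\,\|\,e_{<t})$ for all $t\ge1$ and all $a_{\le t}$, $e_{<t}$. Moreover, let $(w_T)_T$ be any weights on the pTMs such that $T\mapsto w_T$ is lower semicomputable (the limit of a nondecreasing sequence of rationals that is computable uniformly in $T$), $w_T>0$ for all $T$, and $\sum_T w_T\le1$. Then there is a pTM $Q$ such that $\pi_Q(a_{<t}\,\|\,e_{<t})>0$ always, $$\lambda^O_Q(a\mid h)=\sum_T w_T\,\frac{\pi_T(a_{<t}\,\|\,e_{<t})}{\pi_Q(a_{<t}\,\|\,e_{<t})}\,\pi_T(a\mid h)\qquad\text{for all histories } h=a_1e_1\dots a_{t-1}e_{t-1}\text{ and } a\in\mathcal A,$$ and $\zeta:=\pi_Q$ belongs to $\mathcal P^O_{\mathrm{refl}}$, satisfies $\zeta(a_{\le t}\,\|\,e_{<t})\ge\sum_T w_T\,\pi_T(a_{\le t}\,\|\,e_{<t})$ for all $t\ge1$, $a_{\le t}$, $e_{<t}$, and multiplicatively dominates $\mathcal P^O_{\mathrm{refl}}$ in the above sense. -/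

import Mathlib

open scoped ENNReal NNReal
open Filter Topology

namespace ReflectiveOracle

/-- An oracle probabilistic Turing machine is given by its program, i.e. by a code of a partial
recursive function. The program governs the deterministic computation that the machine performs
between two interactions with its random tape or its oracle; how a code is run as a probabilistic
machine is defined by `next`, `transcriptProb` and `outputProb` below. -/
abbrev PTM : Type := Nat.Partrec.Code

/-- A machine reads and writes symbols of the alphabet `Σ = 𝒜 ⊔ ℰ` of actions and percepts. -/
abbrev Sym (𝒜 ℰ : Type*) := 𝒜 ⊕ ℰ

/-- Rational thresholds, the elements of `ℚ ∩ [0,1]`. -/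
abbrev Threshold : Type := Set.Icc (0 : ℚ) 1

/-- The threshold that a machine denotes by writing down a numerator `m` and a denominator `d`
(values above `1` are read as `1`); every element of `ℚ ∩ [0,1]` can be written in this way. -/
def threshold (m d : ℕ) : Threshold :=
  ⟨min ((m : ℚ) / (d : ℚ)) 1, le_min (by positivity) zero_le_one, min_le_right _ _⟩

/-- An oracle: `O T x p α` is the probability that the query `(T, x, p)` with index `α` is answered
by `1`. -/
abbrev Oracle (𝒜 ℰ : Type*) := PTM → List (Sym 𝒜 ℰ) → Threshold → 𝒜 → unitInterval

/-- What a machine does at the end of a stretch of deterministic computation: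
* `inl s`: halt with the single output symbol `s`;
* `inr (inl ())`: read the next fair bit from the random tape;
* `inr (inr (T, x, (m, d), α))`: put the query `(T, x, m / d)` with index `α` to the oracle. -/
abbrev Instr (𝒜 ℰ : Type*) := Sym 𝒜 ℰ ⊕ Unit ⊕ PTM × List (Sym 𝒜 ℰ) × (ℕ × ℕ) × 𝒜

section Machine

variable {𝒜 ℰ : Type*} [Primcodable 𝒜] [Primcodable ℰ]

open Classical in
/-- The next instruction of the machine `T` on input `x`, after it has received the bits `b` so far
(random bits and oracle answers, in chronological order). It is computed by the program `T` from
`x` and `b`; it is `none` if the program diverges or writes something that is not an instruction. -/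
noncomputable def next (T : PTM) (x : List (Sym 𝒜 ℰ)) (b : List Bool) : Option (Instr 𝒜 ℰ) :=
  (T.eval (Encodable.encode (x, b))).toOption.bind Encodable.decode

/-- The probability that the machine, being about to execute the given instruction, receives `i`
as its next bit (`0` if it does not ask for a bit). -/
noncomputable def replyProb (O : Oracle 𝒜 ℰ) : Option (Instr 𝒜 ℰ) → Bool → ℝ≥0∞
  | some (.inr (.inl ())), _ => 2⁻¹
  | some (.inr (.inr (T, x, (m, d), α))), true => ENNReal.ofReal (O T x (threshold m d) α)
  | some (.inr (.inr (T, x, (m, d), α))), false => ENNReal.ofReal (1 - O T x (threshold m d) α)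
  | _, _ => 0

/-- The probability that the run of `T` with oracle `O` on input `x` receives the bits `b` as its
first `b.length` bits. -/
noncomputable def transcriptProb (O : Oracle 𝒜 ℰ) (T : PTM) (x : List (Sym 𝒜 ℰ))
    (b : List Bool) : ℝ≥0∞ :=
  ∏ i : Fin b.length, replyProb O (next T x (b.take i)) (b.get i)

open Classical in
/-- `λ_T^O(α | x)`: the probability that `T` with oracle `O` on input `x` halts with output the
single symbol `α`. -/
noncomputable def outputProb (O : Oracle 𝒜 ℰ) (T : PTM) (x : List (Sym 𝒜 ℰ)) (α : 𝒜) : ℝ≥0∞ :=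
  ∑' b : List Bool, if next T x b = some (.inl (.inl α)) then transcriptProb O T x b else 0

variable [Fintype 𝒜] [DecidableEq 𝒜]

/-- `q` is a family of cutoffs for the machine `T` on input `x`: a probability vector on `𝒜`
between the bounds given by `λ_T^O( · | x)` at which the oracle's answers switch from `1` to `0`. -/
structure IsCutoff (O : Oracle 𝒜 ℰ) (T : PTM) (x : List (Sym 𝒜 ℰ)) (q : PMF 𝒜) : Prop where
  lower : ∀ α, outputProb O T x α ≤ q α
  upper : ∀ α, q α ≤ 1 - ∑ β ∈ Finset.univ.erase α, outputProb O T x β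
  eq_one : ∀ (α : 𝒜) (p : Threshold), ((p : ℚ) : ℝ) < (q α).toReal → O T x p α = 1
  eq_zero : ∀ (α : 𝒜) (p : Threshold), (q α).toReal < ((p : ℚ) : ℝ) → O T x p α = 0

/-- Reflective oracles. -/
def IsReflective (O : Oracle 𝒜 ℰ) : Prop :=
  ∀ (T : PTM) (x : List (Sym 𝒜 ℰ)), ∃ q : PMF 𝒜, IsCutoff O T x q

/-- The cutoffs of a machine on an input are determined by the oracle. -/
theorem IsCutoff.unique {O : Oracle 𝒜 ℰ} {T : PTM} {x : List (Sym 𝒜 ℰ)} {q q' : PMF 𝒜}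
    (h : IsCutoff O T x q) (h' : IsCutoff O T x q') : q = q' := by
  have key : ∀ {r s : PMF 𝒜}, IsCutoff O T x r → IsCutoff O T x s →
      ∀ α, (s α).toReal ≤ (r α).toReal := by
    intro r s hr hs α
    by_contra! hlt
    obtain ⟨p, h1, h2⟩ := exists_rat_btwn hlt
    have h0 : (0 : ℝ) ≤ p := ENNReal.toReal_nonneg.trans h1.le
    have hs1 : (s α).toReal ≤ 1 := ENNReal.toReal_mono ENNReal.one_ne_top (s.coe_le_one α)
    have hp : p ∈ Set.Icc (0 : ℚ) 1 :=
      ⟨by exact_mod_cast h0, by exact_mod_cast h2.le.trans hs1⟩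
    have e1 := hs.eq_one α ⟨p, hp⟩ h2
    have e0 := hr.eq_zero α ⟨p, hp⟩ h1
    exact zero_ne_one (e0.symm.trans e1)
  refine PMF.ext fun α => ?_
  exact (ENNReal.toReal_eq_toReal_iff' (q.apply_ne_top α) (q'.apply_ne_top α)).1
    (le_antisymm (key h' h α) (key h h' α))

end Machine

/-- A strategy: a map from histories `a₁e₁ … aₜ₋₁eₜ₋₁` to distributions of the next action. -/
abbrev Strategy (𝒜 ℰ : Type*) := List (𝒜 × ℰ) → PMF 𝒜

/-- The string `a₁e₁a₂e₂ …` over `Σ` that represents a history on the input tape. -/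
def historyString {𝒜 ℰ : Type*} (h : List (𝒜 × ℰ)) : List (Sym 𝒜 ℰ) :=
  h.flatMap fun ae => [Sum.inl ae.1, Sum.inr ae.2]

/-- `π(a_{<t} ‖ e_{<t})`: the product of the probabilities that `π` gives to the successive actions
of the history. -/
noncomputable def Strategy.prob {𝒜 ℰ : Type*} (π : Strategy 𝒜 ℰ) (h : List (𝒜 × ℰ)) : ℝ≥0∞ :=
  ∏ i : Fin h.length, π (h.take i) (h.get i).1

/-- `π(a_{≤t} ‖ e_{<t})`, where `h` is the history before time `t` and `a` is the action at
time `t`. -/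
noncomputable def Strategy.probAct {𝒜 ℰ : Type*} (π : Strategy 𝒜 ℰ) (h : List (𝒜 × ℰ)) (a : 𝒜) :
    ℝ≥0∞ :=
  π.prob h * π h a

/-- `ζ` multiplicatively dominates `π`: `ζ( · ) ≥ c π( · )` for some constant `c > 0`. -/
def Strategy.Dominates {𝒜 ℰ : Type*} (ζ π : Strategy 𝒜 ℰ) : Prop :=
  ∃ c : ℝ≥0, 0 < c ∧ ∀ (h : List (𝒜 × ℰ)) (a : 𝒜), (c : ℝ≥0∞) * π.probAct h a ≤ ζ.probAct h a

/-- The class of strategies computable with the oracle `O`; for a reflective oracle this is the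
class of reflective-oracle computable strategies. -/
def Prefl {𝒜 ℰ : Type*} [Primcodable 𝒜] [Primcodable ℰ] (O : Oracle 𝒜 ℰ) :
    Set (Strategy 𝒜 ℰ) :=
  {π | ∃ T : PTM, ∀ (h : List (𝒜 × ℰ)) (a : 𝒜), π h a = outputProb O T (historyString h) a}

/-- The strategy given by the completion of the machine `T` by the reflective oracle `O`: its
conditionals are the (unique) cutoffs of `T`. -/
noncomputable def completion {𝒜 ℰ : Type*} [Primcodable 𝒜] [Primcodable ℰ] [Fintype 𝒜]
    [DecidableEq 𝒜] {O : Oracle 𝒜 ℰ} (hO : IsReflective O) (T : PTM) : Strategy 𝒜 ℰ :=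
  fun h => (hO T (historyString h)).choose

/-- Lower semicomputability of a nonnegative function of machines: it is the limit of a computable,
nondecreasing sequence of (nonnegative) rationals, given by numerators and denominators. -/
def IsLowerSemicomputable (w : PTM → ℝ≥0) : Prop :=
  ∃ num den : PTM → ℕ → ℕ, Computable₂ num ∧ Computable₂ den ∧ (∀ T k, den T k ≠ 0) ∧
    ∀ T, Monotone (fun k => (num T k : ℝ) / (den T k : ℝ)) ∧
      Tendsto (fun k => (num T k : ℝ) / (den T k : ℝ)) atTop (𝓝 (w T : ℝ))

end ReflectiveOracle

open ReflectiveOracle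

/-!
The mixture is realised by a machine that refers to its own program. Three facts carry the proof.

*A reflective oracle makes cutoffs computable in the limit.* A query about the cutoff `q` at a
threshold `p ≠ q` has a certain answer; only at `p = q` may the answer be random. Hence, whatever
the random answers are, counting the answers at the thresholds `k / d` gives a lower and an upper
bound for `q` that differ from it by at most `1 / d` once all of these queries have been answered
(`IsCutoff.tendsto_lowerCount`, `IsCutoff.tendsto_upperCount`). "Whatever the answers are" is
expressed by convergence along `approxFilter`, which only sees answers of positive probability.

*Lower approximable subprobability vectors can be sampled exactly* (`outputProb_sampler`,
`exists_ptm_outputProb_eq`). The machine alternates between random bits and the queries of a fixed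
enumeration. After `n` rounds the random bits name one of `2 ^ n` cells of the unit interval; cells
are allocated to actions as the lower bounds for their probabilities grow, and the machine halts
when its own cell is allocated. Since the random bits are independent of the answers
(`freeSum_answers_cell`), the probability of having halted with `α` after `n` rounds is the expected
fraction of cells allocated to `α`. By the recursion theorem the approximated vector may depend on
the machine itself. Applied to the cutoffs of a machine `T`, this shows that the completion of `T`
is computed by some machine (`completion_mem_Prefl`).

*The mixture is well-defined* (`prob_mixture`). The terms `w T * (π_T(h) / π_Q(h)) * π_T(α | h)` can
be approximated from below if `π_Q(h) ≠ 0`, because `π_Q(h)` can be approximated from above, and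
they sum to at most one over `T` and `α` if `∑ w T * π_T(h) ≤ π_Q(h)`. Both conditions propagate
along the history, because the completion of `Q` lies above the output probabilities of `Q`. The
dominance property is then immediate, since a machine whose output probabilities sum to one is equal
to its completion.
-/

namespace ReflectiveOracle

/-! ### Computability of finite sums and products -/

section Computability

variable {α : Type*} [Primcodable α]

theorem computable_sum_range {f : α → ℕ} {g : α → ℕ → ℕ} (hf : Computable f)
    (hg : Computable₂ g) : Computable fun a => ∑ i ∈ Finset.range (f a), g a i := by
  refine (Computable.nat_rec (h := fun a p => p.2 + g a p.1) hf (Computable.const 0) ?_).of_eq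
    fun a => ?_
  · exact Primrec.nat_add.to_comp.comp (Computable.snd.comp Computable.snd)
      (hg.comp Computable.fst (Computable.fst.comp Computable.snd))
  · induction f a with
    | zero => rfl
    | succ n ih => rw [Finset.sum_range_succ, ← ih]

theorem computable_prod_range {f : α → ℕ} {g : α → ℕ → ℕ} (hf : Computable f)
    (hg : Computable₂ g) : Computable fun a => ∏ i ∈ Finset.range (f a), g a i := by
  refine (Computable.nat_rec (h := fun a p => p.2 * g a p.1) hf (Computable.const 1) ?_).of_eq
    fun a => ?_
  · exact Primrec.nat_mul.to_comp.comp (Computable.snd.comp Computable.snd)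
      (hg.comp Computable.fst (Computable.fst.comp Computable.snd))
  · induction f a with
    | zero => rfl
    | succ n ih => rw [Finset.prod_range_succ, ← ih]

theorem computable_two_pow {f : α → ℕ} (hf : Computable f) : Computable fun a => 2 ^ f a :=
  (computable_prod_range (g := fun _ _ => 2) hf (Computable.const 2).to₂).of_eq fun a => by simp

end Computability

/-! ### Sampling machines -/

section Sampler

variable {𝒜 ℰ : Type*}

/-- The answers contained in a transcript in which random bits (at even positions) alternate with
oracle answers (at odd positions). -/
def answers (b : List Bool) : List Bool :=
  (List.range (b.length / 2)).map fun j => b.getD (2 * j + 1) false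

/-- The number whose binary digits are the random bits of a transcript in which random bits
alternate with oracle answers. It names one of the `2 ^ n` cells of level `n = b.length / 2` into
which the unit interval is divided. -/
def cell (b : List Bool) : ℕ :=
  (List.range (b.length / 2)).foldl (fun u j => 2 * u + (b.getD (2 * j) false).toNat) 0

/-- The instruction that puts the `n`-th query of the enumeration of all queries (or reads a dummy
random bit if `n` does not encode a query). -/
def queryInstr [Primcodable 𝒜] [Primcodable ℰ] (n : ℕ) : Instr 𝒜 ℰ :=
  ((Encodable.decode n : Option (PTM × List (Sym 𝒜 ℰ) × (ℕ × ℕ) × 𝒜)).map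
    fun z => .inr (.inr z)).getD (.inr (.inl ()))

section Alloc

variable [DecidableEq 𝒜]

/-- One step of the allocation of cells to actions: every allocated cell is halved, and if `(α, k)`
is requested then fresh cells are added until `α` has `k` of them. -/
def allocStep (L : List 𝒜) (r : Option (𝒜 × ℕ)) : List 𝒜 :=
  L.flatMap (fun α => [α, α]) ++
    (r.map fun p => List.replicate (p.2 - 2 * L.count p.1) p.1).getD []

/-- The allocation of the first cells of level `n` that results from the requests that are made
upon the first `0, …, n` of the answers `a`. -/
def allocUpTo (request : List Bool → Option (𝒜 × ℕ)) (a : List Bool) : ℕ → List 𝒜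
  | 0 => allocStep [] (request [])
  | n + 1 => allocStep (allocUpTo request a n) (request (a.take (n + 1)))

/-- The allocation of cells of level `a.length` upon the answers `a`: the `i`-th entry is the action
that owns the `i`-th cell. -/
def alloc (request : List Bool → Option (𝒜 × ℕ)) (a : List Bool) : List 𝒜 :=
  allocUpTo request a a.length

/-- The instruction of the sampling machine after the transcript `b`: it halts as soon as its random
cell is allocated, and otherwise it alternately reads random bits and puts the queries of the
enumeration, one after the other and regardless of the input. -/
def samplerInstr [Primcodable 𝒜] [Primcodable ℰ] (request : List Bool → Option (𝒜 × ℕ))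
    (b : List Bool) : Instr 𝒜 ℰ :=
  bif b.length.bodd then queryInstr (b.length / 2)
  else (((alloc request (answers b))[cell b]?).map fun α => .inl (.inl α)).getD (.inr (.inl ()))

end Alloc

theorem computable_option_getD_map {α β σ : Type*} [Primcodable α] [Primcodable β] [Primcodable σ]
    {f : α → Option β} {g : α → β → σ} {h : α → σ} (hf : Computable f) (hg : Computable₂ g)
    (hh : Computable h) : Computable fun a => ((f a).map (g a)).getD (h a) :=
  Computable.option_getD (Computable.option_map hf hg) hh

theorem primrec_answers : Primrec answers := by
  refine Primrec.list_map (Primrec.list_range.comp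
    (Primrec.nat_div.comp Primrec.list_length (Primrec.const 2))) ?_
  exact (Primrec.list_getD false).comp Primrec.fst
    (Primrec.nat_add.comp (Primrec.nat_mul.comp (Primrec.const 2) Primrec.snd) (Primrec.const 1))

theorem primrec_cell : Primrec cell := by
  refine Primrec.list_foldl (h := fun b p => 2 * p.1 + (b.getD (2 * p.2) false).toNat)
    (Primrec.list_range.comp (Primrec.nat_div.comp Primrec.list_length (Primrec.const 2)))
    (Primrec.const 0) ?_
  refine Primrec.nat_add.comp (Primrec.nat_mul.comp (Primrec.const 2)
    (Primrec.fst.comp Primrec.snd)) ?_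
  exact (Primrec.dom_finite Bool.toNat).comp ((Primrec.list_getD false).comp Primrec.fst
    (Primrec.nat_mul.comp (Primrec.const 2) (Primrec.snd.comp Primrec.snd)))

variable [Primcodable 𝒜]

/-- Every computable family of instructions that may refer to the program that is being defined is
realised by a machine, by the recursion theorem. -/
theorem exists_ptm_next [Primcodable ℰ] (f : PTM → List (Sym 𝒜 ℰ) × List Bool → Instr 𝒜 ℰ)
    (hf : Computable₂ f) : ∃ T : PTM, ∀ x b, next T x b = some (f T (x, b)) := by
  obtain ⟨T, hT⟩ := Nat.Partrec.Code.fixed_point₂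
    (f := fun c n => ((Encodable.decode n : Option (List (Sym 𝒜 ℰ) × List Bool)).map
      fun p => Encodable.encode (f c p) : Option ℕ)) (by
    refine Computable.ofOption (Computable.option_map
      (Computable.decode.comp Computable.snd) ?_)
    exact Computable.encode.comp (hf.comp (Computable.fst.comp Computable.fst) Computable.snd))
  refine ⟨T, fun x b => ?_⟩
  rw [next, hT]
  simp only [Encodable.encodek, Option.map_some, Part.coe_some, Part.toOption,
    Part.some_dom, dite_true, Part.get_some, Option.bind_some]

variable [DecidableEq 𝒜]

theorem primrec_allocStep : Primrec₂ (allocStep (𝒜 := 𝒜)) := by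
  have hcount : Primrec₂ fun (L : List 𝒜) (α : 𝒜) => L.count α :=
    (Primrec.list_length.comp (PrimrecRel.listFilter (R := (· = ·)) Primrec.eq)).of_eq fun p => by
      dsimp only
      rw [List.count_eq_countP, List.countP_eq_length_filter]; rfl
  have hrep : Primrec₂ fun (k : ℕ) (α : 𝒜) => List.replicate k α :=
    (Primrec.list_map (g := fun (p : ℕ × 𝒜) _ => p.2) (Primrec.list_range.comp Primrec.fst)
      (Primrec.snd.comp Primrec.fst)).of_eq fun p => by simp
  refine Primrec.list_append.comp ?_ ?_
  · exact Primrec.list_flatMap Primrec.fst (Primrec.list_cons.comp Primrec.snd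
      (Primrec.list_cons.comp Primrec.snd (Primrec.const [])))
  · refine Primrec.option_getD.comp (Primrec.option_map Primrec.snd ?_) (Primrec.const [])
    refine hrep.comp (Primrec.nat_sub.comp (Primrec.snd.comp Primrec.snd)
      (Primrec.nat_mul.comp (Primrec.const 2) (hcount.comp (Primrec.fst.comp Primrec.fst)
        (Primrec.fst.comp Primrec.snd)))) (Primrec.fst.comp Primrec.snd)

variable [Primcodable ℰ]

theorem computable_samplerInstr {σ : Type*} [Primcodable σ]
    {request : σ → List Bool → Option (𝒜 × ℕ)} (hr : Computable₂ request) :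
    Computable₂ fun c b => (samplerInstr (request c) b : Instr 𝒜 ℰ) := by
  have hlen : Computable fun p : σ × List Bool => p.2.length :=
    Computable.list_length.comp Computable.snd
  have hans : Computable fun p : σ × List Bool => answers p.2 :=
    primrec_answers.to_comp.comp Computable.snd
  have halloc : Computable fun p : σ × List Bool => alloc (request p.1) (answers p.2) := by
    refine (Computable.nat_rec
      (f := fun p : σ × List Bool => (answers p.2).length)
      (g := fun p : σ × List Bool => allocStep [] (request p.1 []))
      (h := fun p q => allocStep q.2 (request p.1 ((answers p.2).take (q.1 + 1))))
      (Computable.list_length.comp hans)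
      (primrec_allocStep.to_comp.comp (Computable.const [])
        (hr.comp Computable.fst (Computable.const []))) ?_).of_eq fun p => ?_
    · refine primrec_allocStep.to_comp.comp (Computable.snd.comp Computable.snd)
        (hr.comp (Computable.fst.comp Computable.fst) (Primrec.list_take.to_comp.comp
          (Computable.succ.comp (Computable.fst.comp Computable.snd))
          (hans.comp Computable.fst)))
    · rw [alloc]
      induction (answers p.2).length with
      | zero => rfl
      | succ n ih => simp only [allocUpTo, ← ih]
  refine Computable.cond (Computable.nat_bodd.comp hlen) ?_ ?_
  · refine computable_option_getD_map (Computable.decode.comp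
      (Primrec.nat_div.to_comp.comp hlen (Computable.const 2))) ?_ (Computable.const _)
    exact Computable.sumInr.comp (Computable.sumInr.comp Computable.snd)
  · refine computable_option_getD_map (Computable.list_getElem?.comp halloc
      (primrec_cell.to_comp.comp Computable.snd)) ?_ (Computable.const _)
    exact Computable.sumInl.comp (Computable.sumInl.comp Computable.snd)

/-- Sampling machines exist for all computable requests, which may refer to the machine itself. -/
theorem exists_sampler (request : PTM → List (Sym 𝒜 ℰ) → List Bool → Option (𝒜 × ℕ))
    (hr : Computable₂ fun (p : PTM × List (Sym 𝒜 ℰ)) a => request p.1 p.2 a) :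
    ∃ T : PTM, ∀ (x : List (Sym 𝒜 ℰ)) b, next T x b = some (samplerInstr (request T x) b) := by
  refine exists_ptm_next (fun T p => samplerInstr (request T p.1) p.2) ?_
  exact Computable₂.comp
    (f := fun (c : PTM × List (Sym 𝒜 ℰ)) b => (samplerInstr (request c.1 c.2) b : Instr 𝒜 ℰ))
    (g := fun q : PTM × List (Sym 𝒜 ℰ) × List Bool => (q.1, q.2.1)) (h := fun q => q.2.2)
    (computable_samplerInstr hr)
    (Computable.pair Computable.fst (Computable.fst.comp Computable.snd))
    (Computable.snd.comp Computable.snd)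

end Sampler

/-! ### Sums over transcripts -/

section WeightedSum

/-- The sum of `φ` over all bit strings of length `n`, where the string `b` is weighted with the
product of the weights `w (b.take i) b[i]` of its bits. -/
noncomputable def wsum (w : List Bool → Bool → ℝ≥0∞) : ℕ → (List Bool → ℝ≥0∞) → ℝ≥0∞
  | 0, φ => φ []
  | n + 1, φ => wsum w n fun b => ∑ t, w b t * φ (b ++ [t])

variable {w : List Bool → Bool → ℝ≥0∞}

/-- Monotonicity of weighted sums; only the strings with a property `P` that holds along all
transcripts of positive weight have to be compared. -/
theorem wsum_mono_of {P : List Bool → Prop} (h0 : P []) (hP : ∀ b t, P b → w b t ≠ 0 → P (b ++ [t]))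
    (n : ℕ) {φ ψ : List Bool → ℝ≥0∞} (h : ∀ b, P b → b.length = n → φ b ≤ ψ b) :
    wsum w n φ ≤ wsum w n ψ := by
  induction n generalizing φ ψ with
  | zero => exact h [] h0 rfl
  | succ n ih =>
    refine ih fun b hb hn => Finset.sum_le_sum fun t _ => ?_
    by_cases hw : w b t = 0
    · simp [hw]
    · exact mul_le_mul_right (h _ (hP b t hb hw) (by simp [hn])) _

theorem wsum_congr (n : ℕ) {φ ψ : List Bool → ℝ≥0∞} (h : ∀ b, b.length = n → φ b = ψ b) :
    wsum w n φ = wsum w n ψ :=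
  le_antisymm
    (wsum_mono_of (P := fun _ => True) trivial (fun _ _ _ _ => trivial) n fun b _ hb => (h b hb).le)
    (wsum_mono_of (P := fun _ => True) trivial (fun _ _ _ _ => trivial) n fun b _ hb => (h b hb).ge)

theorem wsum_const (n : ℕ) (hw : ∀ b, ∑ t, w b t = 1) (c : ℝ≥0∞) : wsum w n (fun _ => c) = c := by
  induction n with
  | zero => rfl
  | succ n ih => simpa only [wsum, ← Finset.sum_mul, hw, one_mul] using ih

theorem wsum_zero (n : ℕ) : wsum w n (fun _ => 0) = 0 := by
  induction n with
  | zero => rfl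
  | succ n ih => simpa only [wsum, mul_zero, Finset.sum_const_zero] using ih

theorem prod_take_get_concat {β M : Type*} [CommMonoid M] (F : List β → β → M) (l : List β)
    (t : β) : ∏ i : Fin (l ++ [t]).length, F ((l ++ [t]).take i) ((l ++ [t]).get i) =
      (∏ i : Fin l.length, F (l.take i) (l.get i)) * F l t := by
  have hl : l.length + 1 = (l ++ [t]).length := by simp
  rw [← Fin.prod_congr' _ hl, Fin.prod_univ_castSucc]
  congr 1
  · refine Finset.prod_congr rfl fun i _ => ?_
    simp [List.take_append_of_le_length i.2.le]
  · simp

theorem sum_prod_take_get_eq_wsum (n : ℕ) (φ : List Bool → ℝ≥0∞) :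
    ∑ f : Fin n → Bool, (∏ i : Fin (List.ofFn f).length,
      w ((List.ofFn f).take i) ((List.ofFn f).get i)) * φ (List.ofFn f) = wsum w n φ := by
  induction n generalizing φ with
  | zero =>
    rw [Fintype.sum_unique, wsum]
    exact (congrArg (· * φ []) (Fin.prod_univ_zero _)).trans (one_mul _)
  | succ n ih =>
    rw [wsum, ← ih, ← (Fin.snocEquiv fun _ : Fin (n + 1) => Bool).sum_comp,
      Fintype.sum_prod_type_right]
    refine Finset.sum_congr rfl fun f _ => ?_
    rw [Finset.mul_sum]
    refine Finset.sum_congr rfl fun t _ => ?_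
    have h : List.ofFn ((Fin.snocEquiv fun _ : Fin (n + 1) => Bool) (t, f)) =
        List.ofFn f ++ [t] := by
      rw [List.ofFn_succ', List.concat_eq_append]
      simp [Fin.snocEquiv]
    rw [h, prod_take_get_concat, mul_assoc]

end WeightedSum

section Output

variable {𝒜 ℰ : Type*}

theorem sum_replyProb_inr (O : Oracle 𝒜 ℰ) (i : Unit ⊕ PTM × List (Sym 𝒜 ℰ) × (ℕ × ℕ) × 𝒜) :
    ∑ t, replyProb O (some (.inr i)) t = 1 := by
  rcases i with _ | ⟨T, x, ⟨m, d⟩, α⟩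
  · simp only [Fintype.sum_bool, replyProb, ENNReal.inv_two_add_inv_two]
  · simp only [Fintype.sum_bool, replyProb]
    rw [← ENNReal.ofReal_add (O T x (threshold m d) α).2.1 (sub_nonneg.2 (O T x _ α).2.2)]
    simp

variable [Primcodable 𝒜] [Primcodable ℰ]

open Classical in
/-- The probability that `T` with oracle `O` on input `x` halts with output `α` after having
received exactly `n` bits. -/
noncomputable def haltProb (O : Oracle 𝒜 ℰ) (T : PTM) (x : List (Sym 𝒜 ℰ)) (α : 𝒜) (n : ℕ) :
    ℝ≥0∞ :=
  wsum (fun b => replyProb O (next T x b)) n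
    fun b => if next T x b = some (.inl (.inl α)) then 1 else 0

/-- The sum over all transcripts, sorted by their length. -/
theorem outputProb_eq_tsum_haltProb (O : Oracle 𝒜 ℰ) (T : PTM) (x : List (Sym 𝒜 ℰ)) (α : 𝒜) :
    outputProb O T x α = ∑' n, haltProb O T x α n := by
  rw [outputProb, ← List.equivSigmaTuple.symm.tsum_eq, ENNReal.tsum_sigma']
  refine tsum_congr fun n => ?_
  rw [tsum_fintype, haltProb, ← sum_prod_take_get_eq_wsum]
  refine Finset.sum_congr rfl fun f _ => ?_
  rw [mul_ite, mul_one, mul_zero]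
  rfl

theorem sum_replyProb_queryInstr (O : Oracle 𝒜 ℰ) (n : ℕ) :
    ∑ t, replyProb O (some (queryInstr n)) t = 1 := by
  unfold queryInstr
  cases (Encodable.decode n : Option (PTM × List (Sym 𝒜 ℰ) × (ℕ × ℕ) × 𝒜)) with
  | none => exact sum_replyProb_inr O _
  | some z => exact sum_replyProb_inr O _

/-- The answers `a` to the first `a.length` queries are possible: each has positive probability. -/
def Possible (O : Oracle 𝒜 ℰ) (a : List Bool) : Prop :=
  ∀ i t, a[i]? = some t → replyProb O (some (queryInstr i)) t ≠ 0

theorem Possible.concat {O : Oracle 𝒜 ℰ} {a : List Bool} (ha : Possible O a) {t : Bool}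
    (ht : replyProb O (some (queryInstr a.length)) t ≠ 0) : Possible O (a ++ [t]) := by
  intro i s h
  rcases lt_trichotomy i a.length with hi | hi | hi
  · rw [List.getElem?_append_left hi] at h
    exact ha i s h
  · subst hi
    obtain rfl : t = s := by simpa using h
    exact ht
  · rw [List.getElem?_eq_none (by simp; omega)] at h
    cases h

theorem Possible.of_concat {O : Oracle 𝒜 ℰ} {a : List Bool} {t : Bool}
    (ha : Possible O (a ++ [t])) : Possible O a := fun i s h =>
  ha i s (by rw [List.getElem?_append_left (List.getElem?_eq_some_iff.1 h).1, h])

/-- The expectation of `φ` over the answers to the first `n` queries. -/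
noncomputable abbrev answerSum (O : Oracle 𝒜 ℰ) (n : ℕ) (φ : List Bool → ℝ≥0∞) : ℝ≥0∞ :=
  wsum (fun a => replyProb O (some (queryInstr a.length))) n φ

theorem answerSum_mono (O : Oracle 𝒜 ℰ) (n : ℕ) {φ ψ : List Bool → ℝ≥0∞}
    (h : ∀ a, Possible O a → a.length = n → φ a ≤ ψ a) : answerSum O n φ ≤ answerSum O n ψ :=
  wsum_mono_of (P := Possible O) (by intro i t h; simp at h) (fun _ _ ha ht => ha.concat ht) n h

theorem answerSum_const (O : Oracle 𝒜 ℰ) (n : ℕ) (c : ℝ≥0∞) : answerSum O n (fun _ => c) = c :=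
  wsum_const n (fun a => sum_replyProb_queryInstr O a.length) c

end Output

/-! ### The law of a sampling machine -/

section Cells

theorem answers_concat_concat {b : List Bool} {n : ℕ} (hb : b.length = 2 * n) (t t' : Bool) :
    answers (b ++ [t] ++ [t']) = answers b ++ [t'] := by
  have h1 : (b ++ [t] ++ [t']).length / 2 = n + 1 := by simp; omega
  have h2 : b.length / 2 = n := by omega
  rw [answers, answers, h1, h2, List.range_succ, List.map_append]
  congr 1
  · refine List.map_congr_left fun j hj => ?_
    rw [List.mem_range] at hj
    simp only [List.getD_eq_getElem?_getD, List.append_assoc]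
    rw [List.getElem?_append_left (by omega)]
  · simp only [List.map_cons, List.map_nil, List.getD_eq_getElem?_getD]
    rw [List.getElem?_append_right (by simp; omega)]
    simp [hb]

theorem cell_concat_concat {b : List Bool} {n : ℕ} (hb : b.length = 2 * n) (t t' : Bool) :
    cell (b ++ [t] ++ [t']) = 2 * cell b + t.toNat := by
  have h1 : (b ++ [t] ++ [t']).length / 2 = n + 1 := by simp; omega
  have h2 : b.length / 2 = n := by omega
  rw [cell, cell, h1, h2, List.range_succ, List.foldl_append]
  simp only [List.foldl_cons, List.foldl_nil]
  congr 1
  · congr 1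
    refine List.foldl_ext _ _ _ fun u j hj => ?_
    rw [List.mem_range] at hj
    simp only [List.getD_eq_getElem?_getD, List.append_assoc]
    rw [List.getElem?_append_left (by omega)]
  · simp only [List.getD_eq_getElem?_getD, List.append_assoc]
    rw [List.getElem?_append_right (by omega)]
    simp [hb]

theorem sum_range_two_mul {M : Type*} [AddCommMonoid M] (g : ℕ → M) (n : ℕ) :
    ∑ u ∈ Finset.range (2 * n), g u = ∑ u ∈ Finset.range n, (g (2 * u) + g (2 * u + 1)) := by
  induction n with
  | zero => simp
  | succ n ih => rw [mul_add, mul_one, Finset.sum_range_succ, Finset.sum_range_succ, ih,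
      Finset.sum_range_succ, add_assoc]

variable {𝒜 : Type*}

theorem getElem?_double (L : List 𝒜) (u : ℕ) (t : Bool) :
    (L.flatMap fun α => [α, α])[2 * u + t.toNat]? = L[u]? := by
  induction L generalizing u with
  | nil => simp
  | cons β L ih =>
    cases u with
    | zero => cases t <;> simp
    | succ u =>
      have : 2 * (u + 1) + t.toNat = (2 * u + t.toNat) + 1 + 1 := by ring
      rw [this]
      simpa using ih u

variable [DecidableEq 𝒜]

theorem sum_ite_getElem?_eq (L : List 𝒜) (α : 𝒜) (N : ℕ) :
    ∑ u ∈ Finset.range N, (if L[u]? = some α then 1 else 0 : ℝ≥0∞) = (L.take N).count α := by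
  induction N with
  | zero => simp
  | succ N ih =>
    rw [Finset.sum_range_succ, ih, List.take_add_one, List.count_append, Nat.cast_add]
    congr 1
    cases L[N]? with
    | none => simp
    | some β => by_cases h : β = α <;> simp [h]

theorem count_double (L : List 𝒜) (α : 𝒜) :
    (L.flatMap fun α => [α, α]).count α = 2 * L.count α := by
  induction L with
  | nil => simp
  | cons β L ih =>
    by_cases h : β = α <;> simp [List.flatMap_cons, h, ih] ; ring

theorem count_allocStep_le (L : List 𝒜) (r : Option (𝒜 × ℕ)) (α : 𝒜) {c : ℝ≥0∞}
    (hL : (2 * L.count α : ℕ) ≤ c) (hr : ∀ k, r = some (α, k) → (k : ℝ≥0∞) ≤ c) :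
    ((allocStep L r).count α : ℝ≥0∞) ≤ c := by
  rw [allocStep, List.count_append, count_double]
  rcases r with _ | ⟨β, k⟩
  · simpa using hL
  · by_cases h : β = α
    · subst h
      rcases le_total k (2 * L.count β) with hk | hk
      · simpa [Nat.sub_eq_zero_of_le hk] using hL
      · simpa [Nat.add_sub_cancel' hk, ← Nat.cast_add] using hr k rfl
    · simpa [List.count_replicate, h] using hL

theorem le_count_allocStep (L : List 𝒜) (α : 𝒜) (k : ℕ) :
    k ≤ (allocStep L (some (α, k))).count α := by
  rw [allocStep, List.count_append, count_double]
  simp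
  omega

/-- An allocated cell passes its owner on to its two halves. -/
theorem getElem?_allocStep (L : List 𝒜) (r : Option (𝒜 × ℕ)) {u : ℕ} (t : Bool) {α : 𝒜}
    (h : L[u]? = some α) : (allocStep L r)[2 * u + t.toNat]? = some α := by
  rw [allocStep, List.getElem?_append_left, getElem?_double, h]
  refine (List.getElem?_eq_some_iff.1 ((getElem?_double L u t).trans h)).1

variable (request : List Bool → Option (𝒜 × ℕ))

theorem alloc_nil : alloc request [] = allocStep [] (request []) := rfl

theorem alloc_concat (a : List Bool) (t : Bool) :
    alloc request (a ++ [t]) = allocStep (alloc request a) (request (a ++ [t])) := by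
  have h : ∀ n ≤ a.length, allocUpTo request (a ++ [t]) n = allocUpTo request a n := by
    intro n hn
    induction n with
    | zero => rfl
    | succ n ih => rw [allocUpTo, allocUpTo, ih (by omega), List.take_append_of_le_length hn]
  rw [alloc, List.length_append, List.length_singleton, allocUpTo, h _ le_rfl, alloc,
    List.take_of_length_le (by simp)]

theorem le_count_alloc {a : List Bool} {α : 𝒜} {k : ℕ} (h : request a = some (α, k)) :
    k ≤ (alloc request a).count α := by
  rcases List.eq_nil_or_concat a with rfl | ⟨a, t, rfl⟩
  · rw [alloc_nil, h]
    exact le_count_allocStep _ _ _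
  · rw [List.concat_eq_append] at h ⊢
    rw [alloc_concat, h]
    exact le_count_allocStep _ _ _

end Cells

section Rounds

variable {𝒜 ℰ : Type*} [Primcodable 𝒜] [Primcodable ℰ]

theorem queryInstr_ne_inl (n : ℕ) (s : Sym 𝒜 ℰ) : (queryInstr n : Instr 𝒜 ℰ) ≠ .inl s := by
  unfold queryInstr
  cases (Encodable.decode n : Option (PTM × List (Sym 𝒜 ℰ) × (ℕ × ℕ) × 𝒜)) <;> simp

variable (O : Oracle 𝒜 ℰ)

/-- The average of `φ` over a random bit and the answer to the `n`-th query that are received after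
the transcript `b`. -/
noncomputable def roundSum (n : ℕ) (φ : List Bool → ℝ≥0∞) (b : List Bool) : ℝ≥0∞ :=
  ∑ t, 2⁻¹ * ∑ t', replyProb O (some (queryInstr n)) t' * φ (b ++ [t] ++ [t'])

theorem roundSum_const (n : ℕ) (c : ℝ≥0∞) (b : List Bool) : roundSum O n (fun _ => c) b = c := by
  simp only [roundSum, ← Finset.sum_mul, sum_replyProb_queryInstr, one_mul]
  rw [Fintype.sum_bool, ENNReal.inv_two_add_inv_two, one_mul]

theorem roundSum_congr (n : ℕ) {φ ψ : List Bool → ℝ≥0∞} (b : List Bool)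
    (h : ∀ t t', φ (b ++ [t] ++ [t']) = ψ (b ++ [t] ++ [t'])) :
    roundSum O n φ b = roundSum O n ψ b := by
  simp only [roundSum, h]

/-- The sum over the transcripts of `n` rounds, each consisting of a random bit and an oracle
answer, of the machine that never halts. -/
noncomputable def freeSum (O : Oracle 𝒜 ℰ) : ℕ → (List Bool → ℝ≥0∞) → ℝ≥0∞
  | 0, φ => φ []
  | n + 1, φ => freeSum O n (roundSum O n φ)

theorem freeSum_congr (n : ℕ) {φ ψ : List Bool → ℝ≥0∞} (h : ∀ b, b.length = 2 * n → φ b = ψ b) :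
    freeSum O n φ = freeSum O n ψ := by
  induction n generalizing φ ψ with
  | zero => exact h [] rfl
  | succ n ih => exact ih fun b hb => roundSum_congr O n b fun t t' => h _ (by simp [hb]; ring)

theorem freeSum_add (n : ℕ) (φ ψ : List Bool → ℝ≥0∞) :
    freeSum O n (fun b => φ b + ψ b) = freeSum O n φ + freeSum O n ψ := by
  induction n generalizing φ ψ with
  | zero => rfl
  | succ n ih =>
    simp only [freeSum, ← ih]
    refine freeSum_congr O n fun b _ => ?_
    simp only [roundSum, mul_add, Finset.sum_add_distrib]

/-- The random bits are independent of the answers, and they determine a uniformly distributed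
cell. -/
theorem freeSum_answers_cell (n : ℕ) (G : List Bool → ℕ → ℝ≥0∞) :
    freeSum O n (fun b => G (answers b) (cell b)) =
      answerSum O n fun a => (2 ^ n)⁻¹ * ∑ u ∈ Finset.range (2 ^ n), G a u := by
  induction n generalizing G with
  | zero => simp [freeSum, wsum, answers, cell]
  | succ n ih =>
    have h1 : freeSum O (n + 1) (fun b => G (answers b) (cell b)) =
        freeSum O n fun b => ∑ t : Bool, 2⁻¹ * ∑ t' : Bool,
          replyProb O (some (queryInstr n)) t' * G (answers b ++ [t']) (2 * cell b + t.toNat) := by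
      refine freeSum_congr O n fun b hb => ?_
      simp only [roundSum, answers_concat_concat hb, cell_concat_concat hb]
    rw [h1, ih fun a u => ∑ t : Bool, 2⁻¹ * ∑ t' : Bool,
      replyProb O (some (queryInstr n)) t' * G (a ++ [t']) (2 * u + t.toNat)]
    refine wsum_congr n fun a ha => ?_
    have h2 : (2 ^ (n + 1) : ℝ≥0∞)⁻¹ = (2 ^ n)⁻¹ * 2⁻¹ := by
      rw [pow_succ, ENNReal.mul_inv (by simp) (by simp)]
    rw [h2, pow_succ']
    simp only [ha, sum_range_two_mul, Fintype.sum_bool, Bool.toNat_true, Bool.toNat_false, add_zero,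
      Finset.sum_add_distrib, ← Finset.mul_sum, mul_add]
    ring

end Rounds

section SamplerLaw

variable {𝒜 ℰ : Type*} [DecidableEq 𝒜]

/-- The action that owns the random cell of the transcript `b`. -/
def owner (request : List Bool → Option (𝒜 × ℕ)) (b : List Bool) : Option 𝒜 :=
  (alloc request (answers b))[cell b]?

variable {request : List Bool → Option (𝒜 × ℕ)}

theorem owner_concat_concat {b : List Bool} {n : ℕ} (hb : b.length = 2 * n) (t t' : Bool) {α : 𝒜}
    (h : owner request b = some α) : owner request (b ++ [t] ++ [t']) = some α := by
  rw [owner, answers_concat_concat hb, cell_concat_concat hb, alloc_concat]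
  exact getElem?_allocStep _ _ _ h

/-- The indicator of the transcripts that do not determine an output. -/
def unowned (request : List Bool → Option (𝒜 × ℕ)) (b : List Bool) : ℝ≥0∞ :=
  if owner request b = none then 1 else 0

theorem unowned_concat_concat {b : List Bool} {n : ℕ} (hb : b.length = 2 * n)
    (h : owner request b ≠ none) (t t' : Bool) : unowned request (b ++ [t] ++ [t']) = 0 := by
  obtain ⟨α, hα⟩ := Option.ne_none_iff_exists'.1 h
  rw [unowned, owner_concat_concat hb t t' hα]
  simp

variable [Primcodable 𝒜] [Primcodable ℰ]

theorem samplerInstr_even {b : List Bool} {n : ℕ} (hb : b.length = 2 * n) :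
    (samplerInstr request b : Instr 𝒜 ℰ) =
      ((owner request b).map fun α => .inl (.inl α)).getD (.inr (.inl ())) := by
  rw [samplerInstr, hb]
  simp [owner]

theorem samplerInstr_odd {b : List Bool} {n : ℕ} (hb : b.length = 2 * n + 1) :
    (samplerInstr request b : Instr 𝒜 ℰ) = queryInstr n := by
  have h : (2 * n + 1) / 2 = n := by omega
  rw [samplerInstr, hb, h]
  simp

variable {O : Oracle 𝒜 ℰ} {T : PTM} {x : List (Sym 𝒜 ℰ)}

/-- The effect of one round: only the transcripts whose cell is not yet allocated are continued. -/
theorem wsum_round (hT : ∀ b, next T x b = some (samplerInstr request b))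
    (n : ℕ) (φ : List Bool → ℝ≥0∞) :
    wsum (fun b => replyProb O (next T x b)) (2 * (n + 1)) φ =
      wsum (fun b => replyProb O (next T x b)) (2 * n)
        fun b => unowned request b * roundSum O n φ b := by
  rw [mul_add, mul_one, wsum, wsum]
  refine wsum_congr _ fun b hb => ?_
  have h1 : ∀ t, replyProb O (next T x b) t = unowned request b * 2⁻¹ := by
    intro t
    rw [hT, samplerInstr_even hb, unowned]
    cases owner request b <;> simp [replyProb]
  have h2 : ∀ t, next T x (b ++ [t]) = some (queryInstr n) := fun t => by
    rw [hT, samplerInstr_odd (n := n) (by simp [hb])]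
  simp only [h1, h2, roundSum, Finset.mul_sum, mul_assoc]

/-- Until it halts, the machine behaves like the machine that never halts. -/
theorem wsum_unowned (hT : ∀ b, next T x b = some (samplerInstr request b))
    (n : ℕ) (φ : List Bool → ℝ≥0∞) :
    wsum (fun b => replyProb O (next T x b)) (2 * n) (fun b => unowned request b * φ b) =
      freeSum O n fun b => unowned request b * φ b := by
  induction n generalizing φ with
  | zero => rfl
  | succ n ih =>
    rw [wsum_round hT, ih, freeSum]
    refine freeSum_congr O n fun b hb => ?_
    by_cases h : owner request b = none
    · simp [unowned, h]
    · have h0 : unowned request b = 0 := by simp [unowned, h]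
      rw [h0, zero_mul, ← roundSum_const O n 0 b]
      exact roundSum_congr O n b fun t t' => by rw [unowned_concat_concat hb h, zero_mul]

/-- The machine has halted with output `α` within `n` rounds if and only if `α` owns the cell that
the machine that never halts has arrived at after `n` rounds. -/
theorem sum_haltProb_eq_freeSum
    (hT : ∀ b, next T x b = some (samplerInstr request b)) (α : 𝒜) (n : ℕ) :
    ∑ k ∈ Finset.range (2 * n + 1), haltProb O T x α k =
    freeSum O n fun b => if owner request b = some α then 1 else 0 := by
  have heven : ∀ {b : List Bool} {n : ℕ}, b.length = 2 * n →
      (next T x b = some (.inl (.inl α)) ↔ owner request b = some α) := by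
    intro b n hb
    rw [hT, samplerInstr_even hb]
    cases owner request b <;> simp
  induction n with
  | zero =>
    simp only [mul_zero, zero_add, Finset.sum_range_one, haltProb, wsum, freeSum]
    simp only [heven (b := []) (n := 0) rfl]
  | succ n ih =>
    rw [show 2 * (n + 1) + 1 = 2 * n + 1 + 1 + 1 by ring, Finset.sum_range_succ,
      Finset.sum_range_succ, ih]
    -- the machine never halts between a random bit and the query of the same round
    have hodd : haltProb O T x α (2 * n + 1) = 0 := by
      rw [haltProb, wsum_congr (ψ := fun _ => 0) _ fun b hb => ?_, wsum_zero]
      rw [hT, samplerInstr_odd hb]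
      simp [queryInstr_ne_inl]
    rw [hodd, add_zero, show 2 * n + 1 + 1 = 2 * (n + 1) by ring, haltProb, wsum_round hT,
      wsum_unowned hT, ← freeSum_add, freeSum]
    refine freeSum_congr O n fun b hb => ?_
    have hb' : ∀ t t' : Bool, (b ++ [t] ++ [t']).length = 2 * (n + 1) := by simp [hb]; omega
    rw [roundSum_congr O n (ψ := fun b => if owner request b = some α then 1 else 0) b
      fun t t' => by simp only [heven (hb' t t')]]
    cases h : owner request b with
    | none => simp [unowned, h]
    | some β =>
      rw [roundSum_congr O n (ψ := fun _ => if some β = some α then 1 else 0) b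
        fun t t' => by rw [owner_concat_concat hb t t' h], roundSum_const]
      simp [unowned, h]

theorem sum_haltProb_eq_answerSum
    (hT : ∀ b, next T x b = some (samplerInstr request b)) (α : 𝒜) (n : ℕ) :
    ∑ k ∈ Finset.range (2 * n + 1), haltProb O T x α k =
    answerSum O n fun a => (2 ^ n)⁻¹ * (((alloc request a).take (2 ^ n)).count α : ℝ≥0∞) := by
  rw [sum_haltProb_eq_freeSum hT]
  simp only [← sum_ite_getElem?_eq]
  exact freeSum_answers_cell O n fun a u => if (alloc request a)[u]? = some α then 1 else 0

/-- No action receives more cells than its share, if no request does. -/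
theorem count_alloc_le {s : 𝒜 → ℝ≥0∞}
    (hle : ∀ a α k, Possible O a → request a = some (α, k) → (k : ℝ≥0∞) ≤ 2 ^ a.length * s α)
    {a : List Bool} (ha : Possible O a) (α : 𝒜) :
    ((alloc request a).count α : ℝ≥0∞) ≤ 2 ^ a.length * s α := by
  induction a using List.reverseRecOn with
  | nil =>
    rw [alloc_nil]
    exact count_allocStep_le _ _ _ (by simp) fun k hk => hle _ _ _ ha hk
  | append_singleton a t ih =>
    rw [alloc_concat]
    refine count_allocStep_le _ _ _ ?_ fun k hk => hle _ _ _ ha hk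
    rw [Nat.cast_mul, Nat.cast_two, List.length_append, List.length_singleton, pow_succ',
      mul_assoc]
    exact mul_le_mul_right (ih ha.of_concat) 2

/-- The sampling machine outputs `α` with probability `s α` if the requests approximate the
subprobability vector `s` from below, whatever the (possible) answers of the oracle are. -/
theorem outputProb_sampler [Fintype 𝒜]
    (hT : ∀ b, next T x b = some (samplerInstr request b))
    {s : 𝒜 → ℝ≥0∞} (hs : ∑ α, s α ≤ 1)
    (hle : ∀ a α k, Possible O a → request a = some (α, k) → (k : ℝ≥0∞) ≤ 2 ^ a.length * s α)
    (hge : ∀ α r, r < s α → ∃ n, ∀ a, Possible O a → a.length = n →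
      ∃ k, request a = some (α, k) ∧ 2 ^ n * r ≤ k) (α : 𝒜) :
    outputProb O T x α = s α := by
  have hpow : ∀ n : ℕ, (2 ^ n : ℝ≥0∞) ≠ 0 ∧ (2 ^ n : ℝ≥0∞) ≠ ⊤ := fun n => by simp
  rw [outputProb_eq_tsum_haltProb]
  refine le_antisymm ?_ (le_of_forall_lt fun r hr => ?_)
  · refine ENNReal.tsum_le_of_sum_range_le fun n => ?_
    refine (Finset.sum_le_sum_of_subset (Finset.range_mono (by omega : n ≤ 2 * n + 1))).trans ?_
    rw [sum_haltProb_eq_answerSum hT, ← answerSum_const O n (s α)]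
    refine answerSum_mono O n fun a ha hn => ?_
    rw [ENNReal.inv_mul_le_iff (hpow n).1 (hpow n).2, ← hn]
    refine le_trans ?_ (count_alloc_le hle ha α)
    exact_mod_cast (List.take_sublist _ _).count_le _
  · obtain ⟨r', hr, hr'⟩ := exists_between hr
    obtain ⟨n, hn⟩ := hge α r' hr'
    refine hr.trans_le (le_trans ?_ (ENNReal.sum_le_tsum (Finset.range (2 * n + 1))))
    rw [sum_haltProb_eq_answerSum hT, ← answerSum_const O n r']
    refine answerSum_mono O n fun a ha han => ?_
    rw [← ENNReal.mul_le_iff_le_inv (hpow n).1 (hpow n).2]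
    obtain ⟨k, hk, hrk⟩ := hn a ha han
    -- there are enough cells for all requests, since `s` is a subprobability vector
    have hlen : (alloc request a).length ≤ 2 ^ n := by
      have h : ((alloc request a).length : ℝ≥0∞) = ∑ α, ((alloc request a).count α : ℝ≥0∞) := by
        rw [← Nat.cast_sum]
        congr 1
        simpa using (Multiset.sum_count_eq_card (s := Finset.univ)
          (m := (alloc request a : Multiset 𝒜)) (by simp)).symm
      have : ((alloc request a).length : ℝ≥0∞) ≤ 2 ^ n := by
        rw [h]
        calc _ ≤ ∑ α, 2 ^ n * s α := Finset.sum_le_sum fun β _ => han ▸ count_alloc_le hle ha β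
          _ ≤ 2 ^ n := by rw [← Finset.mul_sum]; exact mul_le_of_le_one_right' hs
      exact_mod_cast this
    rw [List.take_of_length_le hlen]
    exact hrk.trans (by exact_mod_cast le_count_alloc request hk)

end SamplerLaw

/-! ### Approximation of the cutoffs by oracle queries -/

section Approximation

theorem toReal_apply_mul_le {𝒜 : Type*} (q : PMF 𝒜) (α : 𝒜) (d : ℕ) : (q α).toReal * d ≤ d :=
  mul_le_of_le_one_left (Nat.cast_nonneg d)
    (ENNReal.toReal_mono ENNReal.one_ne_top (q.coe_le_one α))

variable {𝒜 ℰ : Type*} [Primcodable 𝒜] [Primcodable ℰ]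

/-- The position of the query `(T, x, k / d)` with index `α` in the enumeration of all queries. -/
def queryCode (T : PTM) (x : List (Sym 𝒜 ℰ)) (α : 𝒜) (k d : ℕ) : ℕ :=
  Encodable.encode ((T, x, (k, d), α) : PTM × List (Sym 𝒜 ℰ) × (ℕ × ℕ) × 𝒜)

/-- The number of the thresholds `1 / d, …, d / d` that are answered by `1`. -/
def lowerCount (a : List Bool) (T : PTM) (x : List (Sym 𝒜 ℰ)) (α : 𝒜) (d : ℕ) : ℕ :=
  ∑ k ∈ Finset.range d, (a[queryCode T x α (k + 1) d]? == some true).toNat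

/-- The number of the thresholds `0 / d, …, (d - 1) / d` that are not answered by `0`. -/
def upperCount (a : List Bool) (T : PTM) (x : List (Sym 𝒜 ℰ)) (α : 𝒜) (d : ℕ) : ℕ :=
  ∑ k ∈ Finset.range d, (!(a[queryCode T x α k d]? == some false)).toNat

theorem queryInstr_queryCode (T : PTM) (x : List (Sym 𝒜 ℰ)) (α : 𝒜) (k d : ℕ) :
    queryInstr (queryCode T x α k d) = (.inr (.inr (T, x, (k, d), α)) : Instr 𝒜 ℰ) := by
  simp only [queryInstr, queryCode, Encodable.encodek, Option.map_some, Option.getD_some]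

theorem threshold_eq {k d : ℕ} (hk : k ≤ d) : (threshold k d : ℚ) = k / d :=
  min_eq_left (div_le_one_of_le₀ (by exact_mod_cast hk) (Nat.cast_nonneg d))

/-- Upper bound for the number of the `k < d` with `p k`, all of which satisfy `k + 1 ≤ z`. -/
theorem sum_toNat_le (p : ℕ → Bool) (d : ℕ) {z : ℝ} (hz : 0 ≤ z)
    (h : ∀ k < d, p k = true → (k : ℝ) + 1 ≤ z) :
    ((∑ k ∈ Finset.range d, (p k).toNat : ℕ) : ℝ) ≤ z := by
  refine le_trans ?_ (Nat.floor_le hz)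
  have h1 : ∑ k ∈ Finset.range d, (p k).toNat = ((Finset.range d).filter fun k => p k).card := by
    rw [Finset.card_filter]
    exact Finset.sum_congr rfl fun k _ => by cases p k <;> rfl
  have h2 : ((Finset.range d).filter fun k => p k) ⊆ Finset.range ⌊z⌋₊ := fun k hk => by
    rw [Finset.mem_filter, Finset.mem_range] at hk
    exact Finset.mem_range.2 (Nat.le_floor (by exact_mod_cast h k hk.1 hk.2))
  rw [h1]
  exact_mod_cast (Finset.card_le_card h2).trans_eq (Finset.card_range _)

/-- Lower bound for the number of the `k < d` with `p k`, which include all `k` with `k + 1 < z`. -/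
theorem le_sum_toNat (p : ℕ → Bool) (d : ℕ) {z : ℝ} (hz : z ≤ d + 1)
    (h : ∀ k < d, (k : ℝ) + 1 < z → p k = true) :
    z - 1 ≤ ((∑ k ∈ Finset.range d, (p k).toNat : ℕ) : ℝ) := by
  have h1 : ∑ k ∈ Finset.range d, (p k).toNat = ((Finset.range d).filter fun k => p k).card := by
    rw [Finset.card_filter]
    exact Finset.sum_congr rfl fun k _ => by cases p k <;> rfl
  have hd : ⌈z⌉₊ ≤ d + 1 := Nat.ceil_le.2 (by exact_mod_cast hz)
  have h2 : Finset.range (⌈z⌉₊ - 1) ⊆ (Finset.range d).filter fun k => p k := fun k hk => by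
    rw [Finset.mem_range] at hk
    rw [Finset.mem_filter, Finset.mem_range]
    have hkd : k < d := by omega
    refine ⟨hkd, h k hkd ?_⟩
    exact_mod_cast Nat.lt_ceil.1 (by omega : k + 1 < ⌈z⌉₊)
  have h3 : ⌈z⌉₊ ≤ ((Finset.range d).filter fun k => p k).card + 1 := by
    have := Finset.card_le_card h2
    rw [Finset.card_range] at this
    omega
  rw [h1]
  have h4 : (⌈z⌉₊ : ℝ) ≤ ((Finset.range d).filter fun k => p k).card + 1 := by exact_mod_cast h3
  linarith [Nat.le_ceil z]

variable {O : Oracle 𝒜 ℰ}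

/-- The filter of possible answers to longer and longer initial segments of the queries. -/
def answersFilter (O : Oracle 𝒜 ℰ) : Filter (List Bool) :=
  comap List.length atTop ⊓ 𝓟 {a | Possible O a}

/-- The filter along which first the number of answers and then the resolution tend to infinity.
The approximations converge along it, whatever the (possible) answers are. -/
def approxFilter (O : Oracle 𝒜 ℰ) : Filter (ℕ × List Bool) :=
  (atTop : Filter ℕ).curry (answersFilter O)

theorem eventually_answersFilter {p : List Bool → Prop} :
    (∀ᶠ a in answersFilter O, p a) ↔ ∃ n, ∀ a, Possible O a → n ≤ a.length → p a := by
  rw [answersFilter, eventually_inf_principal, eventually_comap]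
  simp only [eventually_atTop]
  exact ⟨fun ⟨n, h⟩ => ⟨n, fun a ha hn => h _ hn a rfl ha⟩,
    fun ⟨n, h⟩ => ⟨n, fun m hm a ham ha => h a ha (ham ▸ hm)⟩⟩

theorem eventually_possible : ∀ᶠ a in answersFilter O, Possible O a :=
  eventually_answersFilter.2 ⟨0, fun _ ha _ => ha⟩

theorem eventually_complete (T : PTM) (x : List (Sym 𝒜 ℰ)) (α : 𝒜) (d : ℕ) :
    ∀ᶠ a in answersFilter O, ∀ k ≤ d, queryCode T x α k d < a.length := by
  refine eventually_answersFilter.2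
    ⟨(Finset.range (d + 1)).sup (queryCode T x α · d) + 1, fun a _ hn k hk => ?_⟩
  have := Finset.le_sup (f := (queryCode T x α · d)) (Finset.mem_range.2 (Nat.lt_succ_of_le hk))
  exact lt_of_lt_of_le (Nat.lt_succ_of_le this) hn

theorem tendsto_fst_approxFilter : Tendsto Prod.fst (approxFilter O) atTop :=
  tendsto_fst.mono_left curry_le_prod

theorem tendsto_length_approxFilter :
    Tendsto (fun p => p.2.length) (approxFilter O) atTop := by
  have : Tendsto Prod.snd (approxFilter O) (answersFilter O) :=
    tendsto_snd.mono_left curry_le_prod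
  exact (tendsto_comap.mono_left inf_le_left).comp this

theorem tendsto_approxFilter_of_le {f : ℕ × List Bool → ℝ} {z : ℝ}
    (h : ∀ d > 0, ∀ᶠ a in answersFilter O, |f (d, a) - z| ≤ 1 / d) :
    Tendsto f (approxFilter O) (𝓝 z) := by
  rw [tendsto_iff_dist_tendsto_zero]
  have h1 : Tendsto (fun p : ℕ × List Bool => 1 / (p.1 : ℝ)) (approxFilter O) (𝓝 0) :=
    (tendsto_one_div_atTop_nhds_zero_nat (𝕜 := ℝ)).comp tendsto_fst_approxFilter
  have h2 : ∀ᶠ p in approxFilter O, dist (f p) z ≤ 1 / (p.1 : ℝ) :=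
    eventually_curry_iff.2 ((eventually_gt_atTop 0).mono h)
  exact squeeze_zero' (Eventually.of_forall fun _ => dist_nonneg) h2 h1

/-- Rounding down to a whole number of cells does not affect the limit, since the level of the
cells tends to infinity. -/
theorem tendsto_cells {u v : ℕ × List Bool → ℕ} {z : ℝ}
    (h : Tendsto (fun p => (u p : ℝ) / v p) (approxFilter O) (𝓝 z)) :
    Tendsto (fun p => ((2 ^ p.2.length * u p / v p : ℕ) : ℝ) / 2 ^ p.2.length) (approxFilter O)
      (𝓝 z) := by
  have h0 : Tendsto (fun p => (u p : ℝ) / v p - (1 / 2) ^ p.2.length) (approxFilter O) (𝓝 z) := by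
    simpa using h.sub ((tendsto_pow_atTop_nhds_zero_of_lt_one (r := (1 / 2 : ℝ)) (by norm_num)
      (by norm_num)).comp tendsto_length_approxFilter)
  refine tendsto_of_tendsto_of_tendsto_of_le_of_le h0 h (fun p => ?_) fun p => ?_
  · have h1 := (Nat.lt_floor_add_one (((2 ^ p.2.length * u p : ℕ) : ℝ) / (v p : ℝ))).le
    rw [Nat.floor_div_eq_div] at h1
    have h2 : (0 : ℝ) < 2 ^ p.2.length := by positivity
    simp only [one_div, inv_pow]
    rw [le_div_iff₀ h2, sub_mul, inv_mul_cancel₀ h2.ne']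
    push_cast at h1 ⊢
    rw [mul_div_assoc] at h1
    linarith
  · have h1 : ((2 ^ p.2.length * u p / v p : ℕ) : ℝ) ≤ _ := Nat.cast_div_le
    refine div_le_of_le_mul₀ (by positivity) (by positivity) (h1.trans_eq ?_)
    push_cast
    ring

variable [Fintype 𝒜] [DecidableEq 𝒜]

section Cutoff

variable {T : PTM} {x : List (Sym 𝒜 ℰ)} {q : PMF 𝒜} {a : List Bool} {k d : ℕ}

/-- An answer `1` of positive probability at the threshold `k / d` shows `k / d ≤ q α`. -/
theorem IsCutoff.le_of_answer_true (hq : IsCutoff O T x q) {α : 𝒜} (ha : Possible O a)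
    (hd : 0 < d) (hk : k ≤ d) (h : a[queryCode T x α k d]? = some true) :
    (k : ℝ) ≤ (q α).toReal * d := by
  have h1 := ha _ _ h
  rw [queryInstr_queryCode] at h1
  rw [← div_le_iff₀ (by exact_mod_cast hd)]
  by_contra! hlt
  refine h1 ?_
  have h2 := hq.eq_zero α (threshold k d) (by rw [threshold_eq hk]; push_cast; exact hlt)
  simp [replyProb, h2]

/-- An answer `0` of positive probability at the threshold `k / d` shows `q α ≤ k / d`. -/
theorem IsCutoff.le_of_answer_false (hq : IsCutoff O T x q) {α : 𝒜} (ha : Possible O a)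
    (hd : 0 < d) (hk : k ≤ d) (h : a[queryCode T x α k d]? = some false) :
    (q α).toReal * d ≤ k := by
  have h1 := ha _ _ h
  rw [queryInstr_queryCode] at h1
  rw [← le_div_iff₀ (by exact_mod_cast hd)]
  by_contra! hlt
  refine h1 ?_
  have h2 := hq.eq_one α (threshold k d) (by rw [threshold_eq hk]; push_cast; exact hlt)
  simp [replyProb, h2]

theorem IsCutoff.lowerCount_le (hq : IsCutoff O T x q) (ha : Possible O a) (α : 𝒜) (d : ℕ) :
    (lowerCount a T x α d : ℝ) ≤ (q α).toReal * d := by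
  refine sum_toNat_le _ d (by positivity) fun k hk h => ?_
  exact_mod_cast hq.le_of_answer_true ha (by omega) hk (by simpa using h)

theorem IsCutoff.le_upperCount (hq : IsCutoff O T x q) (ha : Possible O a) (α : 𝒜) (d : ℕ) :
    (q α).toReal * d ≤ (upperCount a T x α d : ℝ) := by
  have := le_sum_toNat (fun k => !(a[queryCode T x α k d]? == some false)) d
    (z := (q α).toReal * d + 1) (by linarith [toReal_apply_mul_le q α d]) fun k hk h => by
      by_contra hne
      have := hq.le_of_answer_false ha (by omega) hk.le (by simpa using hne)
      linarith
  simpa [upperCount] using this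

/-- Once all the relevant queries have been answered, the lower count is off by at most one. -/
theorem IsCutoff.le_lowerCount (hq : IsCutoff O T x q) (ha : Possible O a) (α : 𝒜) {d : ℕ}
    (hc : ∀ k ≤ d, queryCode T x α k d < a.length) :
    (q α).toReal * d - 1 ≤ (lowerCount a T x α d : ℝ) := by
  refine le_sum_toNat _ d (by linarith [toReal_apply_mul_le q α d]) fun k hk h => ?_
  have h1 := List.getElem?_eq_getElem (hc (k + 1) hk)
  rw [h1]
  cases h2 : a[queryCode T x α (k + 1) d]'(hc (k + 1) hk) with
  | true => rfl
  | false =>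
    have := hq.le_of_answer_false ha (by omega) hk (h1.trans (congrArg some h2))
    push_cast at this
    linarith

/-- Once all the relevant queries have been answered, the upper count is off by at most one. -/
theorem IsCutoff.upperCount_le (hq : IsCutoff O T x q) (ha : Possible O a) (α : 𝒜) {d : ℕ}
    (hc : ∀ k ≤ d, queryCode T x α k d < a.length) :
    (upperCount a T x α d : ℝ) ≤ (q α).toReal * d + 1 := by
  refine sum_toNat_le _ d (by positivity) fun k hk h => ?_
  have h1 := List.getElem?_eq_getElem (hc k hk.le)
  have h2 : a[queryCode T x α k d]'(hc k hk.le) = true := by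
    rw [h1] at h
    simpa using h
  have := hq.le_of_answer_true ha (by omega) hk.le (h1.trans (congrArg some h2))
  linarith

end Cutoff

theorem IsCutoff.tendsto_lowerCount {T : PTM} {x : List (Sym 𝒜 ℰ)} {q : PMF 𝒜}
    (hq : IsCutoff O T x q) (α : 𝒜) :
    Tendsto (fun p => (lowerCount p.2 T x α p.1 : ℝ) / p.1) (approxFilter O)
      (𝓝 (q α).toReal) := by
  refine tendsto_approxFilter_of_le fun d hd => ?_
  filter_upwards [eventually_possible, eventually_complete T x α d] with a ha hc
  have hd' : (0 : ℝ) < d := by exact_mod_cast hd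
  rw [div_sub' hd'.ne', abs_div, abs_of_pos hd']
  refine div_le_div_of_nonneg_right (abs_le.2 ⟨?_, ?_⟩) hd'.le
  · linarith [hq.le_lowerCount ha α hc]
  · linarith [hq.lowerCount_le ha α d]

theorem IsCutoff.tendsto_upperCount {T : PTM} {x : List (Sym 𝒜 ℰ)} {q : PMF 𝒜}
    (hq : IsCutoff O T x q) (α : 𝒜) :
    Tendsto (fun p => (upperCount p.2 T x α p.1 : ℝ) / p.1) (approxFilter O)
      (𝓝 (q α).toReal) := by
  refine tendsto_approxFilter_of_le fun d hd => ?_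
  filter_upwards [eventually_possible, eventually_complete T x α d] with a ha hc
  have hd' : (0 : ℝ) < d := by exact_mod_cast hd
  rw [div_sub' hd'.ne', abs_div, abs_of_pos hd']
  refine div_le_div_of_nonneg_right (abs_le.2 ⟨?_, ?_⟩) hd'.le
  · linarith [hq.le_upperCount ha α d]
  · linarith [hq.upperCount_le ha α hc]

end Approximation

/-! ### Machines with prescribed lower semicomputable output probabilities -/

section ApproxSampler

variable {𝒜 ℰ : Type*} [Primcodable 𝒜] [Primcodable ℰ]

/-- The request made upon the answers `a`, where `m a α d` is the number of cells of level
`a.length` for `α` at resolution `d`. Every pair `(α, d)` has its turn infinitely often. -/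
def dovetail (m : List Bool → 𝒜 × ℕ → ℕ) (a : List Bool) : Option (𝒜 × ℕ) :=
  (Encodable.decode a.length.unpair.1 : Option (𝒜 × ℕ)).map fun z => (z.1, m a z)

variable [Fintype 𝒜] [DecidableEq 𝒜]

/-- There is a machine that outputs `α` with probability `s α`, for every subprobability vector `s`
that is approximated from below, whatever the answers of the oracle are, by the computable function
`m`. The function may refer to the machine itself. -/
theorem exists_ptm_outputProb_eq (O : Oracle 𝒜 ℰ)
    (m : PTM × List (Sym 𝒜 ℰ) → List Bool → 𝒜 × ℕ → ℕ)
    (hm : Computable fun p : (PTM × List (Sym 𝒜 ℰ)) × List Bool × 𝒜 × ℕ => m p.1 p.2.1 p.2.2) :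
    ∃ T : PTM, ∀ (x : List (Sym 𝒜 ℰ)) (s : 𝒜 → ℝ≥0∞), ∑ α, s α ≤ 1 →
      (∀ a α d, Possible O a → (m (T, x) a (α, d) : ℝ≥0∞) ≤ 2 ^ a.length * s α) →
      (∀ α r, r < s α → ∃ d, ∀ᶠ a in answersFilter O, 2 ^ a.length * r ≤ m (T, x) a (α, d)) →
      ∀ α, outputProb O T x α = s α := by
  obtain ⟨T, hT⟩ := exists_sampler (fun T x => dovetail (m (T, x))) (by
    refine Computable.option_map (Computable.decode.comp (Computable.fst.comp
      (Computable.unpair.comp (Computable.list_length.comp Computable.snd)))) ?_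
    exact Computable.pair (Computable.fst.comp Computable.snd) (Computable.comp
      (g := fun q : ((PTM × List (Sym 𝒜 ℰ)) × List Bool) × 𝒜 × ℕ => (q.1.1, q.1.2, q.2))
      hm (Computable.pair (Computable.fst.comp Computable.fst)
        (Computable.pair (Computable.snd.comp Computable.fst) Computable.snd))))
  refine ⟨T, fun x s hs hle hge α => outputProb_sampler (hT x) hs ?_ ?_ α⟩
  · intro a α k ha h
    obtain ⟨⟨β, d⟩, -, h⟩ := Option.map_eq_some_iff.1 h
    obtain ⟨rfl, rfl⟩ := Prod.mk.inj h
    exact hle a β d ha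
  · intro α r hr
    obtain ⟨d, hd⟩ := hge α r hr
    obtain ⟨n, hn⟩ := eventually_answersFilter.1 hd
    -- a stage at which `(α, d)` has its turn and at which at least `n` answers are known
    refine ⟨Nat.pair (Encodable.encode (α, d)) n, fun a ha han => ⟨m (T, x) a (α, d), ?_, ?_⟩⟩
    · simp only [dovetail, han, Nat.unpair_pair, Encodable.encodek, Option.map_some]
    · rw [← han]
      exact hn a ha (han ▸ Nat.right_le_pair _ _)

end ApproxSampler

/-! ### Probabilities of histories -/

section Path

variable {𝒜 ℰ : Type*}

/-- The product of `g y α` over all prefixes of `x` that consist of a string `y` and an action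
`α`. -/
def pathProd {M : Type*} [CommMonoid M] (g : List (Sym 𝒜 ℰ) → 𝒜 → M) (x : List (Sym 𝒜 ℰ)) : M :=
  ∏ j ∈ Finset.range x.length, (x[j]?.map (Sum.elim (g (x.take j)) fun _ => 1)).getD 1

theorem pathProd_concat {M : Type*} [CommMonoid M] (g : List (Sym 𝒜 ℰ) → 𝒜 → M)
    (y : List (Sym 𝒜 ℰ)) (z : Sym 𝒜 ℰ) :
    pathProd g (y ++ [z]) = pathProd g y * Sum.elim (g y) (fun _ => 1) z := by
  rw [pathProd, List.length_append, List.length_singleton, Finset.prod_range_succ]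
  congr 1
  · refine Finset.prod_congr rfl fun j hj => ?_
    rw [Finset.mem_range] at hj
    rw [List.getElem?_append_left hj, List.take_append_of_le_length hj.le]
  · simp

theorem historyString_concat (h : List (𝒜 × ℰ)) (ae : 𝒜 × ℰ) :
    historyString (h ++ [ae]) = historyString h ++ [Sum.inl ae.1] ++ [Sum.inr ae.2] := by
  simp [historyString]

theorem Strategy.prob_concat (π : Strategy 𝒜 ℰ) (h : List (𝒜 × ℰ)) (ae : 𝒜 × ℰ) :
    π.prob (h ++ [ae]) = π.prob h * π h ae.1 :=
  prod_take_get_concat (fun l (p : 𝒜 × ℰ) => π l p.1) h ae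

theorem Strategy.prob_nil (π : Strategy 𝒜 ℰ) : π.prob [] = 1 := rfl

theorem Strategy.prob_le_one (π : Strategy 𝒜 ℰ) (h : List (𝒜 × ℰ)) : π.prob h ≤ 1 :=
  Finset.prod_le_one' fun _ _ => (π _).coe_le_one _

theorem pathProd_div (g k : List (Sym 𝒜 ℰ) → 𝒜 → ℝ) (x : List (Sym 𝒜 ℰ)) :
    pathProd (fun y α => g y α / k y α) x = pathProd g x / pathProd k x := by
  rw [pathProd, pathProd, pathProd, ← Finset.prod_div_distrib]
  refine Finset.prod_congr rfl fun j _ => ?_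
  rcases x[j]? with _ | _ | _ <;> simp

theorem pathProd_cast (g : List (Sym 𝒜 ℰ) → 𝒜 → ℕ) (x : List (Sym 𝒜 ℰ)) :
    ((pathProd g x : ℕ) : ℝ) = pathProd (fun y α => (g y α : ℝ)) x := by
  rw [pathProd, pathProd, Nat.cast_prod]
  refine Finset.prod_congr rfl fun j _ => ?_
  rcases x[j]? with _ | _ | _ <;> simp

theorem pathProd_nonneg {g : List (Sym 𝒜 ℰ) → 𝒜 → ℝ} (h0 : ∀ y α, 0 ≤ g y α)
    (x : List (Sym 𝒜 ℰ)) : 0 ≤ pathProd g x := by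
  refine Finset.prod_nonneg fun j _ => ?_
  rcases x[j]? with _ | _ | _ <;> simp [h0]

theorem pathProd_mono {g k : List (Sym 𝒜 ℰ) → 𝒜 → ℝ} (h0 : ∀ y α, 0 ≤ g y α)
    (h : ∀ y α, g y α ≤ k y α) (x : List (Sym 𝒜 ℰ)) : pathProd g x ≤ pathProd k x := by
  refine Finset.prod_le_prod (fun j _ => ?_) fun j _ => ?_ <;>
    rcases x[j]? with _ | _ | _ <;> simp [h0, h]

theorem tendsto_pathProd {ι : Type*} {F : Filter ι} {g : ι → List (Sym 𝒜 ℰ) → 𝒜 → ℝ}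
    {k : List (Sym 𝒜 ℰ) → 𝒜 → ℝ} (h : ∀ y α, Tendsto (fun i => g i y α) F (𝓝 (k y α)))
    (x : List (Sym 𝒜 ℰ)) : Tendsto (fun i => pathProd (g i) x) F (𝓝 (pathProd k x)) := by
  refine tendsto_finsetProd _ fun j _ => ?_
  rcases x[j]? with _ | _ | _ <;> simp [h, tendsto_const_nhds]

end Path

/-! ### Computability of the approximations -/

section ApproxComputable

variable {𝒜 ℰ : Type*} [Primcodable 𝒜] [Primcodable ℰ] {σ : Type*} [Primcodable σ]

theorem computable_pathProd {g : σ → List (Sym 𝒜 ℰ) → 𝒜 → ℕ} {x : σ → List (Sym 𝒜 ℰ)}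
    (hg : Computable fun p : σ × List (Sym 𝒜 ℰ) × 𝒜 => g p.1 p.2.1 p.2.2) (hx : Computable x) :
    Computable fun s => pathProd (g s) (x s) := by
  refine computable_prod_range (Computable.list_length.comp hx) ?_
  refine computable_option_getD_map
    (Computable.list_getElem?.comp (hx.comp Computable.fst) Computable.snd) ?_ (Computable.const 1)
  refine (Computable.sumCasesOn
    (f := fun q : (σ × ℕ) × Sym 𝒜 ℰ => q.2)
    (g := fun q α => g q.1.1 ((x q.1.1).take q.1.2) α) (h := fun _ _ => 1)
    Computable.snd ?_ (Computable.const 1).to₂).of_eq fun q => by rcases q with ⟨_, _ | _⟩ <;> rfl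
  have h1 : Computable fun q : ((σ × ℕ) × Sym 𝒜 ℰ) × 𝒜 => q.1.1.1 :=
    Computable.fst.comp (Computable.fst.comp Computable.fst)
  exact Computable.comp (g := fun q : ((σ × ℕ) × Sym 𝒜 ℰ) × 𝒜 =>
      (q.1.1.1, (x q.1.1.1).take q.1.1.2, q.2)) hg
    (h1.pair ((Primrec.list_take.to_comp.comp (Computable.snd.comp
      (Computable.fst.comp Computable.fst)) (hx.comp h1)).pair Computable.snd))

section Counts

variable {a : σ → List Bool} {T : σ → PTM} {x : σ → List (Sym 𝒜 ℰ)} {α : σ → 𝒜} {k d : σ → ℕ}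

theorem computable_queryCode (hT : Computable T) (hx : Computable x) (hα : Computable α)
    (hk : Computable k) (hd : Computable d) :
    Computable fun s => queryCode (T s) (x s) (α s) (k s) (d s) :=
  Computable.encode.comp (hT.pair (hx.pair ((hk.pair hd).pair hα)))

theorem computable_lowerCount (ha : Computable a) (hT : Computable T) (hx : Computable x)
    (hα : Computable α) (hd : Computable d) :
    Computable fun s => lowerCount (a s) (T s) (x s) (α s) (d s) := by
  refine computable_sum_range hd ?_
  refine (Primrec.dom_finite fun o : Option Bool => (o == some true).toNat).to_comp.comp
    (Computable.list_getElem?.comp (ha.comp Computable.fst) ?_)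
  exact computable_queryCode (hT.comp Computable.fst) (hx.comp Computable.fst)
    (hα.comp Computable.fst) (Computable.succ.comp Computable.snd) (hd.comp Computable.fst)

theorem computable_upperCount (ha : Computable a) (hT : Computable T) (hx : Computable x)
    (hα : Computable α) (hd : Computable d) :
    Computable fun s => upperCount (a s) (T s) (x s) (α s) (d s) := by
  refine computable_sum_range hd ?_
  refine (Primrec.dom_finite fun o : Option Bool => (!(o == some false)).toNat).to_comp.comp
    (Computable.list_getElem?.comp (ha.comp Computable.fst) ?_)
  exact computable_queryCode (hT.comp Computable.fst) (hx.comp Computable.fst)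
    (hα.comp Computable.fst) Computable.snd (hd.comp Computable.fst)

end Counts

/-- The numerator of the approximation, at resolution `d` upon the answers `a`, of the contribution
of the machine `T` to the output probability of `α` of the mixture. -/
def mixtureNum (num : PTM → ℕ → ℕ) (a : List Bool) (T : PTM) (x : List (Sym 𝒜 ℰ)) (α : 𝒜)
    (d : ℕ) : ℕ :=
  num T d * (pathProd (fun y β => lowerCount a T y β d) x * lowerCount a T x α d)

/-- The denominator that belongs to `mixtureNum`; here `Q` is the mixture itself. The factors
`1 / d` of the approximations along the history cancel. -/
def mixtureDen (den : PTM → ℕ → ℕ) (a : List Bool) (Q T : PTM) (x : List (Sym 𝒜 ℰ)) (d : ℕ) : ℕ :=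
  den T d * (d * pathProd (fun y β => upperCount a Q y β d) x)

/-- The number of cells of the mixture `c.1` on input `c.2` for an action at a given resolution. -/
def mixtureCells (num den : PTM → ℕ → ℕ) (c : PTM × List (Sym 𝒜 ℰ)) (a : List Bool)
    (z : 𝒜 × ℕ) : ℕ :=
  ∑ i ∈ Finset.range z.2, 2 ^ a.length * mixtureNum num a (Denumerable.ofNat PTM i) c.2 z.1 z.2 /
    mixtureDen den a c.1 (Denumerable.ofNat PTM i) c.2 z.2

theorem computable_mixtureCells {num den : PTM → ℕ → ℕ} (hnum : Computable₂ num)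
    (hden : Computable₂ den) :
    Computable fun p : (PTM × List (Sym 𝒜 ℰ)) × List Bool × 𝒜 × ℕ =>
      mixtureCells num den p.1 p.2.1 p.2.2 := by
  refine computable_sum_range
    (Computable.snd.comp (Computable.snd.comp Computable.snd)) (Computable₂.mk ?_)
  let S := ((PTM × List (Sym 𝒜 ℰ)) × List Bool × 𝒜 × ℕ) × ℕ
  have hQ : Computable fun q : S => q.1.1.1 :=
    Computable.fst.comp (Computable.fst.comp Computable.fst)
  have hx : Computable fun q : S => q.1.1.2 :=
    Computable.snd.comp (Computable.fst.comp Computable.fst)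
  have ha : Computable fun q : S => q.1.2.1 :=
    Computable.fst.comp (Computable.snd.comp Computable.fst)
  have hα : Computable fun q : S => q.1.2.2.1 :=
    Computable.fst.comp (Computable.snd.comp (Computable.snd.comp Computable.fst))
  have hd : Computable fun q : S => q.1.2.2.2 :=
    Computable.snd.comp (Computable.snd.comp (Computable.snd.comp Computable.fst))
  have hT : Computable fun q : S => Denumerable.ofNat PTM q.2 :=
    (Computable.ofNat PTM).comp Computable.snd
  have hy : Computable fun p : S × List (Sym 𝒜 ℰ) × 𝒜 => p.2.1 :=
    Computable.fst.comp Computable.snd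
  have hβ : Computable fun p : S × List (Sym 𝒜 ℰ) × 𝒜 => p.2.2 :=
    Computable.snd.comp Computable.snd
  have mul := Primrec.nat_mul.to_comp
  refine Primrec.nat_div.to_comp.comp (mul.comp
    (computable_two_pow (Computable.list_length.comp ha)) ?_) ?_
  · refine mul.comp (hnum.comp hT hd) (mul.comp (computable_pathProd ?_ hx)
      (computable_lowerCount ha hT hx hα hd))
    exact computable_lowerCount (ha.comp Computable.fst) (hT.comp Computable.fst) hy hβ
      (hd.comp Computable.fst)
  · refine mul.comp (hden.comp hT hd) (mul.comp hd (computable_pathProd ?_ hx))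
    exact computable_upperCount (ha.comp Computable.fst) (hQ.comp Computable.fst) hy hβ
      (hd.comp Computable.fst)

end ApproxComputable

/-! ### The mixture -/

section Mixture

variable {𝒜 ℰ : Type*} [Primcodable 𝒜] [Primcodable ℰ] {O : Oracle 𝒜 ℰ}

theorem natCast_le_two_pow_mul_ofReal {k n : ℕ} {t : ℝ} (h : (k : ℝ) ≤ 2 ^ n * t) :
    (k : ℝ≥0∞) ≤ 2 ^ n * ENNReal.ofReal t := by
  have h := ENNReal.ofReal_le_ofReal h
  rwa [ENNReal.ofReal_natCast, ENNReal.ofReal_mul (by positivity),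
    ENNReal.ofReal_pow (by norm_num), ENNReal.ofReal_ofNat] at h

theorem eventually_two_pow_mul_le {c : ℕ → List Bool → ℕ} {t : ℝ}
    (hlim : Tendsto (fun p => (c p.1 p.2 : ℝ) / 2 ^ p.2.length) (approxFilter O) (𝓝 t))
    {r : ℝ≥0∞} (hr : r < ENNReal.ofReal t) :
    ∀ᶠ d in atTop, ∀ᶠ a in answersFilter O, 2 ^ a.length * r ≤ c d a := by
  have hr_top : r ≠ ⊤ := (hr.trans ENNReal.ofReal_lt_top).ne
  rw [ENNReal.lt_ofReal_iff_toReal_lt hr_top] at hr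
  refine (eventually_curry_iff.1 (hlim.eventually_const_lt hr)).mono
    fun d hd => hd.mono fun a ha => ?_
  rw [lt_div_iff₀' (by positivity)] at ha
  have h := ENNReal.ofReal_le_ofReal ha.le
  rwa [ENNReal.ofReal_natCast, ENNReal.ofReal_mul (by positivity),
    ENNReal.ofReal_pow (by norm_num), ENNReal.ofReal_ofNat, ENNReal.ofReal_toReal hr_top] at h

theorem sum_le_two_pow_mul_tsum {c : ℕ → ℕ} {t : ℕ → ℝ} {d n : ℕ}
    (hle : ∀ i < d, (c i : ℝ) ≤ 2 ^ n * t i) :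
    ((∑ i ∈ Finset.range d, c i : ℕ) : ℝ≥0∞) ≤ 2 ^ n * ∑' i, ENNReal.ofReal (t i) := by
  rw [Nat.cast_sum]
  refine le_trans ?_ (mul_le_mul_right (ENNReal.sum_le_tsum (Finset.range d)) _)
  rw [Finset.mul_sum]
  exact Finset.sum_le_sum fun i hi => natCast_le_two_pow_mul_ofReal (hle i (Finset.mem_range.1 hi))

/-- If the terms of a series are approximated, then the partial sums of the approximations exceed
every number below the sum of the series. -/
theorem exists_eventually_le_sum {c : ℕ → ℕ → List Bool → ℕ} {t : ℕ → ℝ} (ht : ∀ i, 0 ≤ t i)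
    (hlim : ∀ i, Tendsto (fun p => (c i p.1 p.2 : ℝ) / 2 ^ p.2.length) (approxFilter O) (𝓝 (t i)))
    {r : ℝ≥0∞} (hr : r < ∑' i, ENNReal.ofReal (t i)) :
    ∃ d, ∀ᶠ a in answersFilter O,
      2 ^ a.length * r ≤ (∑ i ∈ Finset.range d, c i d a : ℕ) := by
  rw [ENNReal.tsum_eq_iSup_nat, lt_iSup_iff] at hr
  obtain ⟨N, hN⟩ := hr
  rw [← ENNReal.ofReal_sum_of_nonneg fun i _ => ht i] at hN
  have h1 : Tendsto (fun p => ((∑ i ∈ Finset.range N, c i p.1 p.2 : ℕ) : ℝ) / 2 ^ p.2.length)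
      (approxFilter O) (𝓝 (∑ i ∈ Finset.range N, t i)) := by
    simp only [Nat.cast_sum, Finset.sum_div]
    exact tendsto_finsetSum _ fun i _ => hlim i
  obtain ⟨d, h2, hd⟩ := ((eventually_two_pow_mul_le
    (c := fun d a => ∑ i ∈ Finset.range N, c i d a) h1 hN).and (eventually_ge_atTop N)).exists
  refine ⟨d, h2.mono fun a ha => ha.trans ?_⟩
  exact_mod_cast Finset.sum_le_sum_of_subset (Finset.range_mono hd)

theorem mixtureNum_div_mixtureDen (num den : PTM → ℕ → ℕ) (a : List Bool) (Q T : PTM)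
    (x : List (Sym 𝒜 ℰ)) (α : 𝒜) {d : ℕ}
    (hd : 0 < d) :
    (mixtureNum num a T x α d : ℝ) / mixtureDen den a Q T x d = (num T d : ℝ) / den T d *
      (pathProd (fun y β => (lowerCount a T y β d : ℝ) / d) x /
        pathProd (fun y β => (upperCount a Q y β d : ℝ) / d) x) *
      ((lowerCount a T x α d : ℝ) / d) := by
  have hd' : pathProd (fun (_ : List (Sym 𝒜 ℰ)) (_ : 𝒜) => (d : ℝ)) x ≠ 0 := by
    refine Finset.prod_ne_zero_iff.2 fun j _ => ?_
    rcases x[j]? with _ | _ | _ <;> simp [hd.ne']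
  rw [pathProd_div, pathProd_div, div_div_div_cancel_right₀ hd', mixtureNum, mixtureDen]
  push_cast
  rw [pathProd_cast, pathProd_cast, mul_comm (pathProd _ x), mul_div_mul_comm, mul_div_mul_comm]
  ring

/-- A machine that outputs every action with positive probability: it counts its random bits up to
the first `1`. -/
theorem exists_outputProb_ne_zero (O : Oracle 𝒜 ℰ) :
    ∃ T : PTM, ∀ (x : List (Sym 𝒜 ℰ)) (α : 𝒜), outputProb O T x α ≠ 0 := by
  obtain ⟨T, hT⟩ := exists_ptm_next (𝒜 := 𝒜) (ℰ := ℰ) (fun _ p =>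
    bif p.2[p.2.length - 1]? == some true then
      ((Encodable.decode (p.2.length - 1) : Option 𝒜).map fun α => .inl (.inl α)).getD
        (.inr (.inl ()))
    else .inr (.inl ())) (by
    have hb : Computable fun q : PTM × List (Sym 𝒜 ℰ) × List Bool => q.2.2 :=
      Computable.snd.comp Computable.snd
    have hl : Computable fun q : PTM × List (Sym 𝒜 ℰ) × List Bool => q.2.2.length - 1 :=
      Computable.pred.comp (Computable.list_length.comp hb)
    refine Computable.cond ((Primrec.dom_finite fun o : Option Bool => o == some true).to_comp.comp
      (Computable.list_getElem?.comp hb hl)) ?_ (Computable.const _)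
    refine computable_option_getD_map (Computable.decode.comp hl) ?_ (Computable.const _)
    exact Computable.sumInl.comp (Computable.sumInl.comp Computable.snd))
  refine ⟨T, fun x α => ?_⟩
  -- the transcript on which the machine outputs `α`
  let b := List.replicate (Encodable.encode α) false ++ [true]
  have hb : next T x b = some (.inl (.inl α)) := by
    rw [hT]
    simp [b, Encodable.encodek]
  have hpre : ∀ i < b.length, next T x (b.take i) = some (.inr (.inl ())) := by
    intro i hi
    have h1 : b.take i = List.replicate i false := by
      have h2 : i ≤ Encodable.encode α := by simpa [b, Nat.lt_succ_iff] using hi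
      simp [b, List.take_append_of_le_length, h2]
    rw [hT, h1]
    rcases i with _ | i <;> simp
  refine ne_of_gt (lt_of_lt_of_le ?_ (ENNReal.le_tsum b))
  rw [if_pos hb, transcriptProb, pos_iff_ne_zero, Finset.prod_ne_zero_iff]
  intro i _
  rw [hpre i i.2]
  simp [replyProb]

variable [Fintype 𝒜] [DecidableEq 𝒜] (hO : IsReflective O)

/-- The cutoffs of `T` on input `x`. -/
noncomputable def cutoff (T : PTM) (x : List (Sym 𝒜 ℰ)) : PMF 𝒜 := (hO T x).choose

theorem isCutoff_cutoff (T : PTM) (x : List (Sym 𝒜 ℰ)) : IsCutoff O T x (cutoff hO T x) :=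
  (hO T x).choose_spec

theorem completion_apply (T : PTM) (h : List (𝒜 × ℰ)) :
    completion hO T h = cutoff hO T (historyString h) := rfl

theorem toReal_prob_completion (T : PTM) (h : List (𝒜 × ℰ)) :
    ((completion hO T).prob h).toReal =
      pathProd (fun y α => (cutoff hO T y α).toReal) (historyString h) := by
  induction h using List.reverseRecOn with
  | nil => simp [Strategy.prob_nil, historyString, pathProd]
  | append_singleton h ae ih =>
    rw [Strategy.prob_concat, ENNReal.toReal_mul, ih, historyString_concat, pathProd_concat,
      pathProd_concat]
    simp [completion_apply]

/-- Every completion is computed by some machine, which samples the cutoffs. -/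
theorem completion_mem_Prefl (T : PTM) : completion hO T ∈ Prefl O := by
  obtain ⟨S, hS⟩ := exists_ptm_outputProb_eq O
    (fun c a z => 2 ^ a.length * lowerCount a T c.2 z.1 z.2 / z.2) (by
      have hd : Computable fun p : (PTM × List (Sym 𝒜 ℰ)) × List Bool × 𝒜 × ℕ => p.2.2.2 :=
        Computable.snd.comp (Computable.snd.comp Computable.snd)
      have ha : Computable fun p : (PTM × List (Sym 𝒜 ℰ)) × List Bool × 𝒜 × ℕ => p.2.1 :=
        Computable.fst.comp Computable.snd
      refine Primrec.nat_div.to_comp.comp (Primrec.nat_mul.to_comp.comp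
        (computable_two_pow (Computable.list_length.comp ha)) ?_) hd
      exact computable_lowerCount ha (Computable.const T)
        (Computable.snd.comp Computable.fst)
        (Computable.fst.comp (Computable.snd.comp Computable.snd)) hd)
  refine ⟨S, fun h α => (hS (historyString h) (fun α => completion hO T h α) ?_ ?_ ?_ α).symm⟩
  · rw [← tsum_fintype (L := .unconditional _)]
    exact (completion hO T h).tsum_coe.le
  · intro a α d ha
    rw [← ENNReal.ofReal_toReal ((completion hO T h).apply_ne_top α), completion_apply]
    refine natCast_le_two_pow_mul_ofReal
      (Nat.cast_div_le.trans (div_le_of_le_mul₀ (by positivity) (by positivity) ?_))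
    push_cast
    rw [mul_assoc]
    exact mul_le_mul_of_nonneg_left
      ((isCutoff_cutoff hO T (historyString h)).lowerCount_le ha α d) (by positivity)
  · intro α r hr
    rw [← ENNReal.ofReal_toReal ((completion hO T h).apply_ne_top α)] at hr
    have hlim := tendsto_cells (u := fun p => lowerCount p.2 T (historyString h) α p.1)
      (v := Prod.fst) ((isCutoff_cutoff hO T (historyString h)).tendsto_lowerCount α)
    exact (eventually_two_pow_mul_le
      (c := fun d a => 2 ^ a.length * lowerCount a T (historyString h) α d / d) hlim hr).exists

variable {num den : PTM → ℕ → ℕ} {w : PTM → ℝ≥0}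

/-- The contribution of the machine `T` to the output probability of `α` of the mixture `Q`. -/
noncomputable def mixtureTerm (w : PTM → ℝ≥0) (Q T : PTM) (h : List (𝒜 × ℰ)) (α : 𝒜) : ℝ≥0∞ :=
  (w T : ℝ≥0∞) * ((completion hO T).prob h / (completion hO Q).prob h) * completion hO T h α

theorem toReal_mixtureTerm (Q T : PTM) (h : List (𝒜 × ℰ)) (α : 𝒜) :
    (mixtureTerm hO w Q T h α).toReal = w T *
      (pathProd (fun y β => (cutoff hO T y β).toReal) (historyString h) /
        pathProd (fun y β => (cutoff hO Q y β).toReal) (historyString h)) *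
      (cutoff hO T (historyString h) α).toReal := by
  simp only [mixtureTerm, ENNReal.toReal_mul, ENNReal.toReal_div, toReal_prob_completion,
    completion_apply, ENNReal.coe_toReal]

/-- The approximations do not exceed the contribution to the mixture. -/
theorem mixtureNum_div_mixtureDen_le
    (hw : ∀ T d, (num T d : ℝ) / den T d ≤ w T) {Q : PTM} (T : PTM) {h : List (𝒜 × ℰ)}
    (hQ : (completion hO Q).prob h ≠ 0) (α : 𝒜) {a : List Bool} (ha : Possible O a) {d : ℕ}
    (hd : 0 < d) :
    (mixtureNum num a T (historyString h) α d : ℝ) / mixtureDen den a Q T (historyString h) d ≤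
      (mixtureTerm hO w Q T h α).toReal := by
  have hd' : (0 : ℝ) < d := by exact_mod_cast hd
  have hlow : ∀ y β, (lowerCount a T y β d : ℝ) / d ≤ (cutoff hO T y β).toReal := fun y β =>
    (div_le_iff₀ hd').2 ((isCutoff_cutoff hO T y).lowerCount_le ha β d)
  have hup : ∀ y β, (cutoff hO Q y β).toReal ≤ (upperCount a Q y β d : ℝ) / d := fun y β =>
    (le_div_iff₀ hd').2 ((isCutoff_cutoff hO Q y).le_upperCount ha β d)
  have hpos : 0 < pathProd (fun y β => (cutoff hO Q y β).toReal) (historyString h) := by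
    rw [← toReal_prob_completion]
    exact ENNReal.toReal_pos hQ (ne_top_of_le_ne_top ENNReal.one_ne_top (Strategy.prob_le_one _ _))
  rw [mixtureNum_div_mixtureDen _ _ _ _ _ _ _ hd, toReal_mixtureTerm]
  have h1 := pathProd_mono (fun y β => by positivity) hlow (historyString h)
  have h2 := pathProd_mono (fun y β => ENNReal.toReal_nonneg) hup (historyString h)
  have h3 : 0 ≤ pathProd (fun y β => (lowerCount a T y β d : ℝ) / d) (historyString h) :=
    pathProd_nonneg (fun y β => by positivity) _
  have h4 : 0 ≤ pathProd (fun y β => (cutoff hO T y β).toReal) (historyString h) := h3.trans h1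
  refine mul_le_mul (mul_le_mul (hw T d) (div_le_div₀ h4 h1 hpos h2)
    (div_nonneg h3 (hpos.le.trans h2)) (NNReal.coe_nonneg _)) (hlow _ α) (by positivity) ?_
  exact mul_nonneg (NNReal.coe_nonneg _) (div_nonneg h4 hpos.le)

theorem tendsto_mixtureNum_div_mixtureDen
    (hw : ∀ T, Tendsto (fun d => (num T d : ℝ) / den T d) atTop (𝓝 (w T : ℝ))) {Q : PTM} (T : PTM)
    {h : List (𝒜 × ℰ)} (hQ : (completion hO Q).prob h ≠ 0) (α : 𝒜) :
    Tendsto (fun p => (mixtureNum num p.2 T (historyString h) α p.1 : ℝ) /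
      mixtureDen den p.2 Q T (historyString h) p.1) (approxFilter O)
      (𝓝 (mixtureTerm hO w Q T h α).toReal) := by
  have hne : pathProd (fun y β => (cutoff hO Q y β).toReal) (historyString h) ≠ 0 := by
    rw [← toReal_prob_completion]
    exact (ENNReal.toReal_pos hQ
      (ne_top_of_le_ne_top ENNReal.one_ne_top (Strategy.prob_le_one _ _))).ne'
  rw [toReal_mixtureTerm]
  refine Tendsto.congr' (f₁ := fun p => (num T p.1 : ℝ) / den T p.1 *
      (pathProd (fun y β => (lowerCount p.2 T y β p.1 : ℝ) / p.1) (historyString h) /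
        pathProd (fun y β => (upperCount p.2 Q y β p.1 : ℝ) / p.1) (historyString h)) *
      ((lowerCount p.2 T (historyString h) α p.1 : ℝ) / p.1)) ?_ ?_
  · filter_upwards [tendsto_fst_approxFilter.eventually (eventually_gt_atTop 0)] with p hp
    exact (mixtureNum_div_mixtureDen _ _ _ _ _ _ _ hp).symm
  · refine Tendsto.mul (Tendsto.mul ((hw T).comp tendsto_fst_approxFilter) (Tendsto.div
      (tendsto_pathProd (fun y β => ?_) _) (tendsto_pathProd (fun y β => ?_) _) hne))
      ((isCutoff_cutoff hO T _).tendsto_lowerCount α)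
    · exact (isCutoff_cutoff hO T y).tendsto_lowerCount β
    · exact (isCutoff_cutoff hO Q y).tendsto_upperCount β

theorem mixtureTerm_ne_top {Q : PTM} (T : PTM) {h : List (𝒜 × ℰ)}
    (hQ : (completion hO Q).prob h ≠ 0) (α : 𝒜) : mixtureTerm hO w Q T h α ≠ ⊤ :=
  ENNReal.mul_ne_top (ENNReal.mul_ne_top ENNReal.coe_ne_top (ENNReal.div_ne_top
    (ne_top_of_le_ne_top ENNReal.one_ne_top (Strategy.prob_le_one _ _)) hQ))
    ((completion hO T h).apply_ne_top α)

theorem prob_mul_mixtureTerm {Q : PTM} (T : PTM) {h : List (𝒜 × ℰ)}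
    (hQ : (completion hO Q).prob h ≠ 0) (α : 𝒜) :
    (completion hO Q).prob h * mixtureTerm hO w Q T h α =
      w T * (completion hO T).probAct h α := by
  have htop := ne_top_of_le_ne_top ENNReal.one_ne_top (Strategy.prob_le_one (completion hO Q) h)
  rw [mixtureTerm, Strategy.probAct, ← mul_assoc, mul_left_comm, ENNReal.mul_div_cancel hQ htop,
    mul_assoc]

theorem tsum_ofNat_ptm (f : PTM → ℝ≥0∞) : ∑' i, f (Denumerable.ofNat PTM i) = ∑' T, f T :=
  (Denumerable.eqv PTM).symm.tsum_eq f

/-- A machine that mixes the completions of all machines with their posterior weights, as long as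
these are well-defined and sum to at most one. -/
theorem exists_mixture (hw : IsLowerSemicomputable w) :
    ∃ Q : PTM, ∀ h, (completion hO Q).prob h ≠ 0 →
      ∑' T, w T * (completion hO T).prob h ≤ (completion hO Q).prob h →
      ∀ α, outputProb O Q (historyString h) α = ∑' T, mixtureTerm hO w Q T h α := by
  obtain ⟨num, den, hnum, hden, -, hlim⟩ := hw
  have hle : ∀ T d, (num T d : ℝ) / den T d ≤ w T := fun T d =>
    (hlim T).1.ge_of_tendsto (hlim T).2 d
  obtain ⟨Q, hQ⟩ := exists_ptm_outputProb_eq O _ (computable_mixtureCells hnum hden)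
  refine ⟨Q, fun h h0 hsum => ?_⟩
  have hterm : ∀ α, ∑' T, mixtureTerm hO w Q T h α =
      ∑' i, ENNReal.ofReal (mixtureTerm hO w Q (Denumerable.ofNat PTM i) h α).toReal := by
    intro α
    rw [← tsum_ofNat_ptm]
    exact tsum_congr fun i => (ENNReal.ofReal_toReal (mixtureTerm_ne_top hO _ h0 α)).symm
  refine hQ (historyString h) (fun α => ∑' T, mixtureTerm hO w Q T h α) ?_ ?_ ?_
  · have htop := ne_top_of_le_ne_top ENNReal.one_ne_top (Strategy.prob_le_one (completion hO Q) h)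
    rw [← tsum_fintype (L := .unconditional _), ENNReal.tsum_comm]
    simp only [mixtureTerm, ENNReal.tsum_mul_left, PMF.tsum_coe, mul_one]
    simp only [div_eq_mul_inv, ← mul_assoc, ENNReal.tsum_mul_right]
    rw [← div_eq_mul_inv]
    exact ENNReal.div_le_of_le_mul (by rwa [one_mul])
  · intro a α d ha
    rw [hterm]
    refine sum_le_two_pow_mul_tsum (c := fun i => 2 ^ a.length *
      mixtureNum num a (Denumerable.ofNat PTM i) (historyString h) α d /
        mixtureDen den a Q (Denumerable.ofNat PTM i) (historyString h) d) fun i hi => ?_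
    refine Nat.cast_div_le.trans ?_
    push_cast
    rw [mul_div_assoc]
    exact mul_le_mul_of_nonneg_left
      (mixtureNum_div_mixtureDen_le hO hle _ h0 α ha (by omega)) (by positivity)
  · intro α r hr
    rw [hterm] at hr
    exact exists_eventually_le_sum (c := fun i d a => 2 ^ a.length *
      mixtureNum num a (Denumerable.ofNat PTM i) (historyString h) α d /
        mixtureDen den a Q (Denumerable.ofNat PTM i) (historyString h) d)
      (fun _ => ENNReal.toReal_nonneg)
      (fun i => tendsto_cells (tendsto_mixtureNum_div_mixtureDen hO (fun T => (hlim T).2) _ h0 α))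
      hr

/-- By induction along the history: the mixture gives every history positive probability, at least
the weighted sum of the probabilities that the completions of all machines give to it. -/
theorem prob_mixture (hpos : ∀ T, 0 < w T) (hsum : ∑' T, (w T : ℝ≥0∞) ≤ 1) {Q : PTM}
    (hQ : ∀ h, (completion hO Q).prob h ≠ 0 →
      ∑' T, w T * (completion hO T).prob h ≤ (completion hO Q).prob h →
      ∀ α, outputProb O Q (historyString h) α = ∑' T, mixtureTerm hO w Q T h α)
    (h : List (𝒜 × ℰ)) : (completion hO Q).prob h ≠ 0 ∧
      ∑' T, w T * (completion hO T).prob h ≤ (completion hO Q).prob h := by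
  induction h using List.reverseRecOn with
  | nil => simpa [Strategy.prob_nil] using hsum
  | append_singleton h ae ih =>
    have hle : ∑' T, w T * (completion hO T).prob (h ++ [ae]) ≤
        (completion hO Q).prob (h ++ [ae]) := by
      calc ∑' T, w T * (completion hO T).prob (h ++ [ae])
          = (completion hO Q).prob h * outputProb O Q (historyString h) ae.1 := by
            rw [hQ h ih.1 ih.2, ← ENNReal.tsum_mul_left]
            refine tsum_congr fun T => ?_
            rw [prob_mul_mixtureTerm hO T ih.1, Strategy.prob_concat, Strategy.probAct]
        _ ≤ (completion hO Q).prob (h ++ [ae]) := by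
            rw [Strategy.prob_concat]
            exact mul_le_mul_right ((isCutoff_cutoff hO Q _).lower ae.1) _
    refine ⟨?_, hle⟩
    -- some summand on the left of `hle` is positive
    obtain ⟨T, hT⟩ := exists_outputProb_ne_zero O
    have hT' : (completion hO T).prob (h ++ [ae]) ≠ 0 := by
      rw [Strategy.prob, Finset.prod_ne_zero_iff]
      intro i _ h0
      exact hT _ _ (le_zero_iff.1 (((isCutoff_cutoff hO T _).lower _).trans_eq h0))
    refine ne_of_gt (lt_of_lt_of_le ?_ ((ENNReal.le_tsum T).trans hle))
    exact pos_iff_ne_zero.2 (mul_ne_zero (by exact_mod_cast (hpos T).ne') hT')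

/-- If the output probabilities of a machine sum to one, then its completion has no choice but to
agree with them. -/
theorem completion_eq_of_outputProb {π : Strategy 𝒜 ℰ} {T : PTM}
    (hT : ∀ h a, π h a = outputProb O T (historyString h) a) : completion hO T = π := by
  funext h
  have hle : ∀ a, π h a ≤ completion hO T h a := fun a =>
    (hT h a).trans_le ((isCutoff_cutoff hO T _).lower a)
  -- of two probability vectors, none is strictly above the other
  refine PMF.ext fun a => le_antisymm ?_ (hle a)
  by_contra! hlt
  refine (ENNReal.tsum_lt_tsum (π h).tsum_coe_ne_top hle hlt).ne ?_
  rw [PMF.tsum_coe, PMF.tsum_coe]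

end Mixture

theorem isLowerSemicomputable_two_pow :
    IsLowerSemicomputable fun T => ((2 : ℝ≥0)⁻¹) ^ (Encodable.encode T + 1) := by
  refine ⟨fun _ _ => 1, fun T _ => 2 ^ (Encodable.encode T + 1), Computable.const 1,
    computable_two_pow (Computable.succ.comp (Computable.encode.comp Computable.fst)),
    fun T _ => by positivity, fun T => ⟨fun _ _ _ => le_rfl, ?_⟩⟩
  simp

theorem tsum_two_pow_encode_le :
    ∑' T : PTM, ((((2 : ℝ≥0)⁻¹) ^ (Encodable.encode T + 1) : ℝ≥0) : ℝ≥0∞) ≤ 1 := by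
  rw [← tsum_ofNat_ptm]
  simp only [Denumerable.encode_ofNat, ENNReal.coe_pow]
  rw [ENNReal.coe_inv two_ne_zero, ENNReal.coe_ofNat, ENNReal.tsum_geometric_add_one,
    ENNReal.one_sub_inv_two, inv_inv, ENNReal.inv_mul_cancel two_ne_zero ENNReal.ofNat_ne_top]


end ReflectiveOracle

theorem mainTheorem1 {𝒜 ℰ : Type*} [Fintype 𝒜] [DecidableEq 𝒜] [Primcodable 𝒜]
    [Fintype ℰ] [Primcodable ℰ] (O : Oracle 𝒜 ℰ) (hO : IsReflective O) :
    (∃ ζ ∈ Prefl O, ∀ π ∈ Prefl O, Strategy.Dominates ζ π) ∧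
    ∀ w : PTM → ℝ≥0, IsLowerSemicomputable w → (∀ T, 0 < w T) →
      ∑' T, (w T : ℝ≥0∞) ≤ 1 →
      ∃ Q : PTM,
        (∀ h, (completion hO Q).prob h ≠ 0) ∧
        (∀ h a, outputProb O Q (historyString h) a =
          ∑' T, (w T : ℝ≥0∞) * ((completion hO T).prob h / (completion hO Q).prob h) *
            completion hO T h a) ∧
        completion hO Q ∈ Prefl O ∧
        (∀ h a, ∑' T, (w T : ℝ≥0∞) * (completion hO T).probAct h a ≤
          (completion hO Q).probAct h a) ∧
        ∀ π ∈ Prefl O, Strategy.Dominates (completion hO Q) π := by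
  refine and_iff_right_of_imp (fun key => ?_) |>.2 fun w hw hpos hsum => ?_
  · obtain ⟨Q, -, -, hQ, -, hdom⟩ := key _ isLowerSemicomputable_two_pow
      (fun T => by positivity) tsum_two_pow_encode_le
    exact ⟨completion hO Q, hQ, hdom⟩
  · obtain ⟨Q, hQ⟩ := exists_mixture hO hw
    have hprob := prob_mixture hO hpos hsum hQ
    have hact : ∀ h a, ∑' T, (w T : ℝ≥0∞) * (completion hO T).probAct h a ≤
        (completion hO Q).probAct h a := fun h a => by
      simp only [← fun T => prob_mul_mixtureTerm hO (w := w) T (hprob h).1 a]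
      rw [ENNReal.tsum_mul_left, ← hQ h (hprob h).1 (hprob h).2]
      exact mul_le_mul_right ((isCutoff_cutoff hO Q _).lower a) _
    refine ⟨Q, fun h => (hprob h).1, fun h => hQ h (hprob h).1 (hprob h).2,
      completion_mem_Prefl hO Q, hact, fun π ⟨T, hT⟩ => ⟨w T, hpos T, fun h a => ?_⟩⟩
    rw [← completion_eq_of_outputProb hO hT]
    exact (ENNReal.le_tsum T).trans (hact h a)
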